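/- Let $n\ge 1$. An $n$-dimensional VASS-MDP $S=\langle Q,Q_1,Q_P,T,\tau\rangle$ consists of a finite set $Q$ of control states partitioned into $Q_1$ (Player 1, the controller) and $Q_P$ (Player P, the probabilistic player), a finite set $T\subseteq Q\times\mathbb{Z}^n\times Q$ of transitions, and positive integer weights $\tau(t)$, $t\in T$. It is a P-VASS-MDP if $z=0$ for every $(q,z,q')\in T$ with $q\in Q_1$. It induces a Markov decision process on the configurations $(q,v)\in Q\times\mathbb{N}^n$: a transition $(q,z,q')$ is enabled at $(q,v)$ if $v+z\ge 0$ and then leads to $(q',v+z)$. At a configuration with at least one enabled transition, Player 1 chooses a successor if $q\in Q_1$ (a strategy $\sigma$ is a function of the finite play so far); if $q\in Q_P$, one of the enabled transitions is taken at random with probability proportional to its weight. A configuration without enabled transitions is a deadlock (deadlocks are allowed, for both players). A play is maximal if it is infinite or ends in a deadlock. A strategy $\sigma$ and an initial configuration $c_0$ determine the set of maximal plays from $c_0$ that respect $\sigma$ and a probability measure $\mathbb{P}_{c_0}^{\sigma}$ on maximal plays. Given $S$, $c_0$ and a control state $q_F\in Q$, the objective $\Diamond q_F$ (reachability) is the set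 of infinite plays that visit $q_F$, and $\Box\Diamond q_F$ (repeated reachability) is the set of infinite plays that visit $q_F$ infinitely often. For an objective $A$, the sure problem asks whether there is a strategy $\sigma$ such that all maximal plays from $c_0$ that respect $\sigma$ lie in $A$; the almost-sure problem asks whether there is a strategy $\sigma$ with $\mathbb{P}_{c_0}^{\sigma}(A)=1$; the limit-sure problem asks whether $\sup_\sigma \mathbb{P}_{c_0}^{\sigma}(A)=1$. **Theorem.** For $2$-dimensional P-VASS-MDPs (with deadlocks allowed), each of the following six problems, with input $(S,c_0,q_F)$, is undecidable: sure reachability, almost-sure reachability, limit-sure reachability, sure repeated reachability, almost-sure repeated reachability, limit-sure repeated reachability. The three reachability problems are undecidable also if $\Diamond q_F$ is read as the set of all maximal plays, infinite or deadlocked, that visit $q_F$. -/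

import Mathlib

open scoped ENNReal

namespace VASSInduced

/-! ### Markov decision processes with possible deadlocks -/

/-- A Markov decision process on the set of configurations `C`.  The configurations of Player 1
are `player1`; all the others belong to Player P (the probabilistic player).  Every configuration
of Player P that is not a deadlock carries a probability distribution whose support is exactly
its set of successors. -/
structure MDP (C : Type) where
  player1 : Set C
  step : C → C → Prop
  p : ∀ c : C, c ∉ player1 → (∃ c', step c c') → PMF C
  p_pos : ∀ c hP hc c', 0 < p c hP hc c' ↔ step c c'

namespace MDP

variable {C : Type}

def IsDeadlock (M : MDP C) (c : C) : Prop := ¬ ∃ c', M.step c c'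

/-- A strategy of Player 1: a (deterministic, history dependent) choice of a successor for every
finite play `ρ ++ [c]` whose last configuration `c` is a configuration of Player 1 that is not a
deadlock.  The values of `choose` on other lists are never used. -/
structure Strategy (M : MDP C) where
  choose : List C → C
  legal : ∀ (ρ : List C) (c : C), List.IsChain M.step (ρ ++ [c]) → c ∈ M.player1 →
    ¬ M.IsDeadlock c → M.step c (choose (ρ ++ [c]))

/-- The finite play `ω 0, …, ω n` (entries `none`, which stand for "the play has stopped",
are dropped). -/
def history {n : ℕ} (ω : Fin (n + 1) → Option C) : List C :=
  (List.ofFn ω).reduceOption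

/-- The maximal plays of `M` that start in `c₀` and respect `σ`.  A maximal play is coded as a
sequence `ℕ → Option C`: an infinite play `c₀ c₁ …` is `some c₀, some c₁, …`, and a play
`c₀ … c_k` that ends in a deadlock `c_k` is `some c₀, …, some c_k, none, none, …`. -/
def plays (M : MDP C) (c₀ : C) (σ : M.Strategy) : Set (ℕ → Option C) :=
  {ω | ω 0 = some c₀ ∧ ∀ n : ℕ,
    (ω n = none → ω (n + 1) = none) ∧
    ∀ c, ω n = some c →
      (M.IsDeadlock c → ω (n + 1) = none) ∧
      (¬ M.IsDeadlock c → c ∈ M.player1 →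
        ω (n + 1) = some (σ.choose (history fun i : Fin (n + 1) => ω i))) ∧
      (¬ M.IsDeadlock c → c ∉ M.player1 → ∃ c', M.step c c' ∧ ω (n + 1) = some c')}

/-- Each one-step outcome is measurable; sequences carry the product σ-algebra, which is the
σ-algebra generated by the cylinders. -/
instance optionMeasurableSpace : MeasurableSpace (Option C) := ⊤

open Classical in
/-- The law of the `(n+1)`-st entry of the play, given its entries `0, …, n`. -/
noncomputable def nextPMF (M : MDP C) (σ : M.Strategy) (n : ℕ)
    (h : Fin (n + 1) → Option C) : PMF (Option C) :=
  match h (Fin.last n) with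
  | none => PMF.pure none
  | some c =>
    if hc : ∃ c', M.step c c' then
      if hP : c ∉ M.player1 then (M.p c hP hc).map some
      else PMF.pure (some (σ.choose (history h)))
    else PMF.pure none

/-- `nextPMF` as a Markov kernel from initial segments of plays. -/
noncomputable def nextKernel [Countable C] (M : MDP C) (σ : M.Strategy) (n : ℕ) :
    ProbabilityTheory.Kernel (∀ _ : Finset.Iic n, Option C) (Option C) where
  toFun h := (M.nextPMF σ n fun i =>
    h ⟨i, Finset.mem_Iic.2 (Nat.lt_succ_iff.1 i.2)⟩).toMeasure
  measurable' := measurable_of_countable _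

instance [Countable C] (M : MDP C) (σ : M.Strategy) (n : ℕ) :
    ProbabilityTheory.IsMarkovKernel (M.nextKernel σ n) :=
  ⟨fun _ => PMF.toMeasure.isProbabilityMeasure _⟩

/-- The probability measure on plays induced by the initial configuration `c₀` and the strategy
`σ` (through the Ionescu-Tulcea theorem). -/
noncomputable def playMeasure [Countable C] (M : MDP C) (c₀ : C) (σ : M.Strategy) :
    MeasureTheory.Measure (ℕ → Option C) :=
  ProbabilityTheory.Kernel.traj (X := fun _ => Option C) (M.nextKernel σ) 0 (fun _ => some c₀)

instance [Countable C] (M : MDP C) (c₀ : C) (σ : M.Strategy) :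
    MeasureTheory.IsProbabilityMeasure (M.playMeasure c₀ σ) := by
  unfold playMeasure
  infer_instance

/-- The maximal probability of the event `A`: the supremum over all strategies. -/
noncomputable def maxProb [Countable C] (M : MDP C) (c₀ : C) (A : Set (ℕ → Option C)) : ℝ≥0∞ :=
  ⨆ σ : M.Strategy, M.playMeasure c₀ σ A

def Surely (M : MDP C) (c₀ : C) (A : Set (ℕ → Option C)) : Prop :=
  ∃ σ : M.Strategy, M.plays c₀ σ ⊆ A

def AlmostSurely [Countable C] (M : MDP C) (c₀ : C) (A : Set (ℕ → Option C)) : Prop :=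
  ∃ σ : M.Strategy, M.playMeasure c₀ σ A = 1

def LimitSurely [Countable C] (M : MDP C) (c₀ : C) (A : Set (ℕ → Option C)) : Prop :=
  M.maxProb c₀ A = 1

end MDP

/-! ### VASS-MDPs -/

abbrev Transition (Q : Type) (n : ℕ) : Type := Q × (Fin n → ℤ) × Q

abbrev Config (Q : Type) (n : ℕ) : Type := Q × (Fin n → ℕ)

/-- An `n`-dimensional VASS-MDP with control states `Q`: the control states of Player 1 are `Q₁`,
those of Player P are the complement of `Q₁`; `T` is the finite set of transitions and `τ`
assigns a positive integer weight to each transition. -/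
structure VASSMDP (Q : Type) (n : ℕ) where
  Q₁ : Finset Q
  T : Finset (Transition Q n)
  τ : {t : Transition Q n // t ∈ T} → ℕ+

namespace VASSMDP

variable {Q : Type} {n : ℕ}

def Enabled (c : Config Q n) (t : Transition Q n) : Prop :=
  t.1 = c.1 ∧ ∀ i, 0 ≤ (c.2 i : ℤ) + t.2.1 i

/-- The configuration reached by `t` (meaningful when `t` is enabled at `c`). -/
def fire (c : Config Q n) (t : Transition Q n) : Config Q n :=
  (t.2.2, fun i => ((c.2 i : ℤ) + t.2.1 i).toNat)

def Step (S : VASSMDP Q n) (c c' : Config Q n) : Prop :=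
  ∃ t ∈ S.T, Enabled c t ∧ fire c t = c'

open Classical in
/-- The sum of the weights of the transitions enabled at `c` that lead to `c'`. -/
noncomputable def stepWeight (S : VASSMDP Q n) (c c' : Config Q n) : ℕ :=
  ∑ t : {t : Transition Q n // t ∈ S.T},
    if Enabled c t.1 ∧ fire c t.1 = c' then (S.τ t : ℕ) else 0

open Classical in
/-- The sum of the weights of all transitions enabled at `c`. -/
noncomputable def totalWeight (S : VASSMDP Q n) (c : Config Q n) : ℕ :=
  ∑ t : {t : Transition Q n // t ∈ S.T}, if Enabled c t.1 then (S.τ t : ℕ) else 0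

theorem stepWeight_pos_iff (S : VASSMDP Q n) (c c' : Config Q n) :
    0 < S.stepWeight c c' ↔ S.Step c c' := by
  classical
  unfold stepWeight Step
  rw [Finset.sum_pos_iff]
  constructor
  · rintro ⟨t, -, ht⟩
    by_cases h : Enabled c t.1 ∧ fire c t.1 = c'
    · exact ⟨t.1, t.2, h⟩
    · simp [h] at ht
  · rintro ⟨t, ht, h⟩
    exact ⟨⟨t, ht⟩, Finset.mem_univ _, by simp [h.1, h.2]⟩

theorem totalWeight_ne_zero (S : VASSMDP Q n) (c : Config Q n) (hc : ∃ c', S.Step c c') :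
    S.totalWeight c ≠ 0 := by
  classical
  obtain ⟨c', t, ht, h⟩ := hc
  unfold totalWeight
  refine (Finset.sum_pos_iff.2 ⟨⟨t, ht⟩, Finset.mem_univ _, ?_⟩).ne'
  simp [h.1]

theorem hasSum_stepWeight (S : VASSMDP Q n) (c : Config Q n) :
    HasSum (fun c' => (S.stepWeight c c' : ℝ≥0∞)) (S.totalWeight c : ℝ≥0∞) := by
  classical
  simp only [stepWeight, totalWeight, Nat.cast_sum]
  refine hasSum_sum fun t _ => ?_
  by_cases h : Enabled c t.1
  · simpa [h, eq_comm] using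
      hasSum_ite_eq (fire c t.1) ((S.τ t : ℕ) : ℝ≥0∞)
  · simp [h]

/-- The distribution over the successors of `c`: the probability of `c'` is the total weight of
the enabled transitions that lead from `c` to `c'`, divided by the total weight of the enabled
transitions. -/
noncomputable def stepPMF (S : VASSMDP Q n) (c : Config Q n) (hc : ∃ c', S.Step c c') :
    PMF (Config Q n) :=
  ⟨fun c' => (S.stepWeight c c' : ℝ≥0∞) / (S.totalWeight c : ℝ≥0∞), by
    have h := ENNReal.summable.hasSum (f := fun c' =>
      (S.stepWeight c c' : ℝ≥0∞) / (S.totalWeight c : ℝ≥0∞))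
    simp only [div_eq_mul_inv] at h ⊢
    rw [ENNReal.tsum_mul_right, (S.hasSum_stepWeight c).tsum_eq,
      ENNReal.mul_inv_cancel (by exact_mod_cast S.totalWeight_ne_zero c hc)
        (ENNReal.natCast_ne_top _)] at h
    exact h⟩

/-- The MDP induced by a VASS-MDP. -/
noncomputable def toMDP (S : VASSMDP Q n) : MDP (Config Q n) where
  player1 := {c | c.1 ∈ S.Q₁}
  step := S.Step
  p c _ hc := S.stepPMF c hc
  p_pos c _ hc c' := by
    rw [← stepWeight_pos_iff]
    change 0 < (S.stepWeight c c' : ℝ≥0∞) / (S.totalWeight c : ℝ≥0∞) ↔ _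
    rw [ENNReal.div_pos_iff]
    simp [pos_iff_ne_zero]

/-- P-VASS-MDPs: transitions leaving control states of Player 1 do not change the counters. -/
def IsPVASSMDP (S : VASSMDP Q n) : Prop :=
  ∀ t ∈ S.T, t.1 ∈ S.Q₁ → t.2.1 = 0

end VASSMDP

/-! ### Objectives -/

section Objectives

variable {Q : Type} {n : ℕ}

/-- The infinite plays that visit the control state `qF`. -/
def reachInfinite (qF : Q) : Set (ℕ → Option (Config Q n)) :=
  {ω | (∀ i, ω i ≠ none) ∧ ∃ i v, ω i = some (qF, v)}

/-- The maximal plays, infinite or deadlocked, that visit the control state `qF`. -/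
def reachMaximal (qF : Q) : Set (ℕ → Option (Config Q n)) :=
  {ω | ∃ i v, ω i = some (qF, v)}

/-- The infinite plays that visit the control state `qF` infinitely often. -/
def repeatedReach (qF : Q) : Set (ℕ → Option (Config Q n)) :=
  {ω | (∀ i, ω i ≠ none) ∧ {i | ∃ v, ω i = some (qF, v)}.Infinite}

end Objectives

/-! ### Decision problems for 2-dimensional P-VASS-MDPs -/

/-- An instance: a 2-dimensional P-VASS-MDP with control states `0, …, k - 1`, an initial
configuration and a target control state. -/
structure PInstance where
  k : ℕ
  S : VASSMDP (Fin k) 2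
  isP : S.IsPVASSMDP
  init : Config (Fin k) 2
  target : Fin k

/-- Finite words that describe instances: the list of owners of the control states
(`true` for Player 1), the list of the transitions `((q, (z₁, z₂), q'), weight)`, the initial
configuration `(q, (v₁, v₂))` and the target control state. -/
abbrev Code : Type :=
  List Bool × List ((ℕ × (ℤ × ℤ) × ℕ) × ℕ) × (ℕ × ℕ × ℕ) × ℕ

/-- `w` describes the instance `I`; the transitions may be listed in any order. -/
def Represents (w : Code) (I : PInstance) : Prop :=
  w.1 = List.ofFn (fun q : Fin I.k => decide (q ∈ I.S.Q₁)) ∧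
  w.2.1.Nodup ∧
  (∀ x, x ∈ w.2.1 ↔ ∃ t : {t : Transition (Fin I.k) 2 // t ∈ I.S.T},
    x = (((t.1.1 : ℕ), (t.1.2.1 0, t.1.2.1 1), (t.1.2.2 : ℕ)), (I.S.τ t : ℕ))) ∧
  w.2.2.1 = ((I.init.1 : ℕ), I.init.2 0, I.init.2 1) ∧
  w.2.2.2 = (I.target : ℕ)

/-- A decision problem on instances is decidable if some total computable function gives the
right answer on every description of every instance. -/
def IsDecidable (P : PInstance → Prop) : Prop :=
  ∃ f : Code → Bool, Computable f ∧ ∀ w I, Represents w I → (f w = true ↔ P I)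

def SureReach (I : PInstance) : Prop :=
  I.S.toMDP.Surely I.init (reachInfinite I.target)

def AlmostSureReach (I : PInstance) : Prop :=
  I.S.toMDP.AlmostSurely I.init (reachInfinite I.target)

def LimitSureReach (I : PInstance) : Prop :=
  I.S.toMDP.LimitSurely I.init (reachInfinite I.target)

def SureReachMaximal (I : PInstance) : Prop :=
  I.S.toMDP.Surely I.init (reachMaximal I.target)

def AlmostSureReachMaximal (I : PInstance) : Prop :=
  I.S.toMDP.AlmostSurely I.init (reachMaximal I.target)

def LimitSureReachMaximal (I : PInstance) : Prop :=
  I.S.toMDP.LimitSurely I.init (reachMaximal I.target)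

def SureRepeatedReach (I : PInstance) : Prop :=
  I.S.toMDP.Surely I.init (repeatedReach I.target)

def AlmostSureRepeatedReach (I : PInstance) : Prop :=
  I.S.toMDP.AlmostSurely I.init (repeatedReach I.target)

def LimitSureRepeatedReach (I : PInstance) : Prop :=
  I.S.toMDP.LimitSurely I.init (repeatedReach I.target)

end VASSInduced

/-! The halting problem is reduced to all nine problems at once, through a game that simulates a
two-counter machine. At each instruction Player 1, who cannot touch the counters, only claims that
the tested counter is positive or that it is zero; Player P then executes the claimed branch. After
"positive" the only move is the subtraction, so a claim that cannot be carried out deadlocks. After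
"zero" there are two moves of equal weight: go on, or subtract 1 from the tested counter and enter a
dead sink. The second is disabled exactly when the claim is true. Hence honesty is free of risk, and
a lie is fatal with probability at least 1/2.

If the machine halts, the honest strategy forces every play into the target loop for ever
(`plays_honest_subset`): even repeated reachability holds surely. If it does not halt, any play that
visits the target contains a lie, and a superharmonic function bounds the probability of a visit by
1/2 under every strategy (`isSuperharmonic_gameValue`, `playMeasure_reachMaximal_le`). Every
objective lies between repeated reachability and a mere visit, and every mode between sure and
limit-sure, so this gap decides all cases (`not_isDecidable_of_bounds`).

What remains is one fixed two-counter machine with an undecidable halting problem. Registers are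
stored as exponents of primes in the first counter; the second is scratch space for multiplication,
division and divisibility tests. This yields while programs, hence all primitive recursive functions
(`Nat.Primrec'.implementable`), hence an unbounded search for a halting time of a given code
(`Fragment.exists_universal`). The machine being fixed, the input only affects the initial counter
value, and the reduction is computable. -/

namespace VASSInduced

/-! ### Plays and their measure -/

namespace MDP

open MeasureTheory ProbabilityTheory

variable {C : Type}

theorem history_succ {n : ℕ} (ω : ℕ → Option C) :
    history (fun i : Fin (n + 1 + 1) => ω i) =
      history (fun i : Fin (n + 1) => ω i) ++ (ω (n + 1)).toList := by
  unfold history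
  rw [List.ofFn_succ_last, List.reduceOption_append]
  congr 1

theorem history_eq_of_eq_some {n : ℕ} {ω : ℕ → Option C} {c : C} (h : ω n = some c) :
    ∃ ρ, history (fun i : Fin (n + 1) => ω i) = ρ ++ [c] := by
  cases n with
  | zero => exact ⟨[], by simp [history, h]⟩
  | succ n => exact ⟨_, by rw [history_succ, h]; rfl⟩

variable {M : MDP C} {c₀ : C} {σ : M.Strategy}

/-- Legality of a strategy is only promised on histories that are paths of `M`; this supplies that
hypothesis along every play. -/
theorem isChain_history {ω : ℕ → Option C} (hω : ω ∈ M.plays c₀ σ) (n : ℕ) (c : C)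
    (hc : ω n = some c) : List.IsChain M.step (history fun i : Fin (n + 1) => ω i) := by
  induction n generalizing c with
  | zero => simp [history, hc]
  | succ n ih =>
    cases hn : ω n with
    | none => simp [(hω.2 n).1 hn] at hc
    | some d =>
      have hd := ih d hn
      obtain ⟨ρ, hρ⟩ := history_eq_of_eq_some hn
      rw [history_succ, hc, hρ]
      rw [hρ] at hd
      refine List.isChain_append.2 ⟨hd, by simp, ?_⟩
      have key := (hω.2 n).2 d hn
      have hstep : M.step d c := by
        by_cases hD : M.IsDeadlock d
        · simp [key.1 hD] at hc
        by_cases hP : d ∈ M.player1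
        · have h1 := key.2.1 hD hP
          rw [hc, hρ] at h1
          rw [Option.some.inj h1]
          exact σ.legal ρ d hd hP hD
        · obtain ⟨c', h1, h2⟩ := key.2.2 hD hP
          rw [hc] at h2
          rwa [Option.some.inj h2]
      simpa using hstep

theorem step_of_mem_plays {ω : ℕ → Option C} (hω : ω ∈ M.plays c₀ σ) (n : ℕ) (c : C)
    (hc : ω n = some c) (hP : c ∈ M.player1) (hD : ¬ M.IsDeadlock c) :
    M.step c (σ.choose (history fun i : Fin (n + 1) => ω i)) := by
  obtain ⟨ρ, hρ⟩ := history_eq_of_eq_some hc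
  have := isChain_history hω n c hc
  rw [hρ] at this ⊢
  exact σ.legal ρ c this hP hD

/-! ### The law of the next entry, and supermartingale bounds -/

variable [Countable C]

/-- The defining property of the Ionescu-Tulcea measure. The expectation of the next entry and its
almost sure range both follow from this identity. -/
theorem map_playMeasure (M : MDP C) (c₀ : C) (σ : M.Strategy) (n : ℕ) :
    (M.playMeasure c₀ σ).map (fun ω => (Preorder.frestrictLe n ω, ω (n + 1))) =
      ((M.playMeasure c₀ σ).map (Preorder.frestrictLe n)) ⊗ₘ (M.nextKernel σ n) := by
  unfold playMeasure
  rw [← Kernel.partialTraj_compProd_eq_map_traj (X := fun _ => Option C) (Nat.zero_le n),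
    ← Kernel.map_apply _ (Preorder.measurable_frestrictLe n), Kernel.traj_map_frestrictLe]

theorem lintegral_playMeasure_next (M : MDP C) (c₀ : C) (σ : M.Strategy) (n : ℕ)
    (V : Option C → ℝ≥0∞) :
    ∫⁻ ω, V (ω (n + 1)) ∂(M.playMeasure c₀ σ) =
      ∫⁻ ω, ∑' x, M.nextPMF σ n (fun i => ω i) x * V x ∂(M.playMeasure c₀ σ) := by
  have hV : Measurable V := measurable_of_countable _
  have h1 : ∫⁻ ω, V (ω (n + 1)) ∂(M.playMeasure c₀ σ) = ∫⁻ q, V q.2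
      ∂((M.playMeasure c₀ σ).map (fun ω => (Preorder.frestrictLe (π := fun _ => Option C) n ω,
        ω (n + 1)))) := by
    rw [lintegral_map (by fun_prop) (by fun_prop)]
  rw [h1, map_playMeasure, Measure.lintegral_compProd (by fun_prop),
    lintegral_map (measurable_of_countable _) (by fun_prop)]
  refine lintegral_congr fun ω => ?_
  rw [lintegral_countable']
  refine tsum_congr fun x => ?_
  rw [mul_comm]
  congr 1
  exact PMF.toMeasure_apply_singleton _ _ (MeasurableSet.of_discrete)

theorem ae_mem_support (M : MDP C) (c₀ : C) (σ : M.Strategy) (n : ℕ) :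
    ∀ᵐ ω ∂(M.playMeasure c₀ σ), ω (n + 1) ∈ (M.nextPMF σ n (fun i => ω i)).support := by
  have h : ∀ᵐ q ∂((M.playMeasure c₀ σ).map
      (fun ω => (Preorder.frestrictLe (π := fun _ => Option C) n ω, ω (n + 1)))),
      q.2 ∈ (M.nextPMF σ n fun i =>
        q.1 ⟨i, Finset.mem_Iic.2 (Nat.lt_succ_iff.1 i.2)⟩).support := by
    rw [map_playMeasure, Measure.ae_compProd_iff (MeasurableSet.of_discrete)]
    refine Filter.Eventually.of_forall fun h => ?_
    rw [ae_iff]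
    change (PMF.toMeasure _) _ = 0
    rw [PMF.toMeasure_apply_eq_zero_iff _ (MeasurableSet.of_discrete)]
    exact Set.disjoint_left.2 fun x hx hx' => hx' hx
  exact ae_of_ae_map (by fun_prop) h

theorem ae_zero (M : MDP C) (c₀ : C) (σ : M.Strategy) :
    ∀ᵐ ω ∂(M.playMeasure c₀ σ), ω 0 = some c₀ := by
  have h : (M.playMeasure c₀ σ).map (Preorder.frestrictLe (π := fun _ => Option C) 0) =
      Measure.dirac (fun _ => some c₀) := by
    unfold playMeasure
    rw [← Kernel.map_apply _ (Preorder.measurable_frestrictLe 0), Kernel.traj_map_frestrictLe,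
      Kernel.partialTraj_self, Kernel.id_apply]
  have h2 : ∀ᵐ q ∂((M.playMeasure c₀ σ).map (Preorder.frestrictLe (π := fun _ => Option C) 0)),
      q ⟨0, by simp⟩ = some c₀ := by
    rw [h, ae_dirac_iff MeasurableSet.of_discrete]
  exact ae_of_ae_map (by fun_prop) h2

/-- Links the combinatorial and the probabilistic semantics: sure winning implies almost-sure
winning, and path arguments become available almost everywhere. -/
theorem ae_mem_plays (M : MDP C) (c₀ : C) (σ : M.Strategy) :
    ∀ᵐ ω ∂(M.playMeasure c₀ σ), ω ∈ M.plays c₀ σ := by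
  filter_upwards [ae_zero M c₀ σ, ae_all_iff.2 (ae_mem_support M c₀ σ)] with ω h0 h
  refine ⟨h0, fun n => ⟨fun hn => ?_, fun c hc => ⟨fun hD => ?_, fun hD hP => ?_, fun hD hP => ?_⟩⟩⟩
  · have := h n
    simpa [nextPMF, hn] using this
  · have := h n
    unfold IsDeadlock at hD
    simpa [nextPMF, hc, hD] using this
  · have := h n
    unfold IsDeadlock at hD
    simpa [nextPMF, hc, not_not.1 hD, hP] using this
  · have := h n
    unfold IsDeadlock at hD
    simp only [nextPMF, Fin.val_last, hc, not_not.1 hD, hP, not_false_eq_true, dite_true,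
      PMF.support_map] at this
    obtain ⟨c', h1, h2⟩ := this
    exact ⟨c', (M.p_pos _ _ _ _).1 ((PMF.apply_pos_iff _ _).2 h1), h2.symm⟩

theorem playMeasure_eq_one_of_plays_subset {A : Set (ℕ → Option C)}
    (hA : M.plays c₀ σ ⊆ A) : M.playMeasure c₀ σ A = 1 := by
  have : ∀ᵐ ω ∂(M.playMeasure c₀ σ), ω ∈ A := (ae_mem_plays M c₀ σ).mono fun ω h => hA h
  -- `A` is not assumed measurable; it is null measurable because its complement is null.
  exact (prob_compl_eq_zero_iff₀ (by
    exact NullMeasurableSet.of_compl (NullMeasurableSet.of_null this))).1 this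

/-- `V` does not increase in expectation, whatever Player 1 does. -/
structure IsSuperharmonic (M : MDP C) (V : Option C → ℝ≥0∞) : Prop where
  none_eq : V none = 0
  player1 : ∀ c ∈ M.player1, ∀ c', M.step c c' → V (some c') ≤ V (some c)
  playerP : ∀ c hP hc, ∑' c', M.p c hP hc c' * V (some c') ≤ V (some c)

theorem IsSuperharmonic.lintegral_le {V : Option C → ℝ≥0∞} (hV : M.IsSuperharmonic V) (n : ℕ) :
    ∫⁻ ω, V (ω n) ∂(M.playMeasure c₀ σ) ≤ V (some c₀) := by
  induction n with
  | zero =>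
    rw [lintegral_congr_ae ((ae_zero M c₀ σ).mono fun ω h => by rw [h])]
    simp
  | succ n ih =>
    refine le_trans ?_ ih
    rw [lintegral_playMeasure_next]
    refine lintegral_mono_ae ((ae_mem_plays M c₀ σ).mono fun ω hω => ?_)
    have pure_le : ∀ x y : Option C, V x ≤ V y → ∑' z, PMF.pure x z * V z ≤ V y := by
      intro x y hxy
      rw [tsum_eq_single x (fun z hz => by simp [hz])]
      simpa using hxy
    cases hn : ω n with
    | none => simp [nextPMF, hn]
    | some c =>
      by_cases hc : ∃ c', M.step c c'
      · by_cases hP : c ∉ M.player1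
        · simp only [nextPMF, Fin.val_last, hn, hc, hP, not_false_eq_true, dite_true]
          refine le_trans (le_of_eq ?_) (hV.playerP c hP hc)
          -- Since `V none = 0`, the sum over `Option C` reduces to a sum over `C`.
          rw [← (Option.some_injective C).tsum_eq (by
            rintro (_ | x) hx
            · simp [hV.none_eq] at hx
            · exact ⟨x, rfl⟩)]
          refine tsum_congr fun c' => ?_
          congr 1
          rw [PMF.map_apply, tsum_eq_single c']
          · simp
          · intro b hb
            simp [hb.symm]
        · have := step_of_mem_plays hω n c hn (not_not.1 hP) (not_not.2 hc)
          simpa [nextPMF, hn, hc, hP] using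
            pure_le _ (some c) (hV.player1 c (not_not.1 hP) _ this)
      · simpa [nextPMF, hn, hc] using pure_le none (some c) (by simp [hV.none_eq])

/-- As `B` is absorbing and free of deadlocks, a visit up to time `n` means being in `B` at time
`n`, where `V ≥ 1`. Markov's inequality bounds this by the expectation of `V` at time `n`, uniformly
in `n`; then `n` tends to infinity. -/
theorem IsSuperharmonic.playMeasure_le {V : Option C → ℝ≥0∞} (hV : M.IsSuperharmonic V)
    (B : Set C) (hB : ∀ c ∈ B, 1 ≤ V (some c))
    (habs : ∀ c ∈ B, ¬ M.IsDeadlock c ∧ ∀ c', M.step c c' → c' ∈ B) :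
    M.playMeasure c₀ σ {ω | ∃ i, ∃ c ∈ B, ω i = some c} ≤ V (some c₀) := by
  let E : ℕ → Set (ℕ → Option C) := fun n => {ω | ∃ i ≤ n, ∃ c ∈ B, ω i = some c}
  have hE : {ω : ℕ → Option C | ∃ i, ∃ c ∈ B, ω i = some c} = ⋃ n, E n := by
    ext ω
    simp only [Set.mem_ofPred_eq, Set.mem_iUnion, E]
    exact ⟨fun ⟨i, h⟩ => ⟨i, i, le_rfl, h⟩, fun ⟨_, i, _, h⟩ => ⟨i, h⟩⟩
  have hmono : Monotone E := fun a b hab ω ⟨i, hi, h⟩ => ⟨i, hi.trans hab, h⟩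
  rw [hE, hmono.measure_iUnion]
  refine iSup_le fun n => ?_
  refine le_trans ?_ (hV.lintegral_le (c₀ := c₀) (σ := σ) n)
  have hmeas : Measurable fun ω : ℕ → Option C => V (ω n) :=
    (measurable_of_countable V).comp (measurable_pi_apply n)
  refine le_trans (measure_mono_ae ?_)
    ((mul_meas_ge_le_lintegral hmeas 1).trans' (by rw [one_mul]))
  filter_upwards [ae_mem_plays M c₀ σ] with ω hω hEn
  obtain ⟨i, hi, hc⟩ := hEn
  have : ∃ c ∈ B, ω n = some c := by
    clear hmeas
    induction n, hi using Nat.le_induction with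
    | base => exact hc
    | succ n hn ih =>
      obtain ⟨c, hcB, hcn⟩ := ih
      have hD := (habs c hcB).1
      by_cases hP : c ∈ M.player1
      · exact ⟨_, (habs c hcB).2 _ (step_of_mem_plays hω n c hcn hP hD),
          ((hω.2 n).2 c hcn).2.1 hD hP⟩
      · obtain ⟨c', h1, h2⟩ := ((hω.2 n).2 c hcn).2.2 hD hP
        exact ⟨c', (habs c hcB).2 _ h1, h2⟩
  obtain ⟨c, hcB, hcn⟩ := this
  change 1 ≤ V (ω n)
  rw [hcn]
  exact hB c hcB

end MDP

/-! ### Two-counter machines -/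

/-- An instruction of a two-counter machine: if the counter `i` is zero, go to `t'`; otherwise
subtract `k + 1` from it (if this is impossible, the machine is stuck), add `m` to the other
counter and go to `t`. -/
structure Instr (E : Type) where
  i : Fin 2
  k : ℕ
  m : ℕ
  t : E
  t' : E

namespace Instr

variable {E E' : Type}

def map (f : E → E') (I : Instr E) : Instr E' := ⟨I.i, I.k, I.m, f I.t, f I.t'⟩

def next (I : Instr E) (v : Fin 2 → ℕ) : Fin 2 → ℕ :=
  fun j => if j = I.i then v j - (I.k + 1) else v j + I.m

end Instr

/-- The step relation of a two-counter machine with labels `L`; `none` is the exit. -/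
inductive MStep {L : Type} (code : L → Instr (Option L)) :
    Option L × (Fin 2 → ℕ) → Option L × (Fin 2 → ℕ) → Prop
  | zero (l v) : v (code l).i = 0 → MStep code (some l, v) ((code l).t', v)
  | pos (l v) : (code l).k < v (code l).i → MStep code (some l, v) ((code l).t, (code l).next v)

abbrev MReach {L : Type} (code : L → Instr (Option L)) :
    Option L × (Fin 2 → ℕ) → Option L × (Fin 2 → ℕ) → Prop :=
  Relation.ReflTransGen (MStep code)

theorem MStep.det {L : Type} {code : L → Instr (Option L)} {a b c : Option L × (Fin 2 → ℕ)}
    (hb : MStep code a b) (hc : MStep code a c) : b = c := by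
  cases hb <;> cases hc <;> first | rfl | omega

/-- By determinism the halting run is the only run, so no infinite run starts at `a`. -/
theorem MReach.acc {L : Type} {code : L → Instr (Option L)} {a : Option L × (Fin 2 → ℕ)}
    {w : Fin 2 → ℕ} (h : MReach code a (none, w)) :
    Acc (Function.swap (MStep code)) a := by
  induction h using Relation.ReflTransGen.head_induction_on with
  | refl => exact ⟨_, fun b hb => by cases hb⟩
  | head h1 _ ih => exact ⟨_, fun b hb => by rwa [hb.det h1]⟩

/-- A machine that can always make progress within the set `I` never reaches the exit. -/
theorem not_mreach_none {L : Type} {code : L → Instr (Option L)}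
    (I : Set (Option L × (Fin 2 → ℕ)))
    (hI : ∀ a ∈ I, ∃ b ∈ I, Relation.TransGen (MStep code) a b)
    {a : Option L × (Fin 2 → ℕ)} (ha : a ∈ I) (w : Fin 2 → ℕ) :
    ¬ MReach code a (none, w) := by
  intro h
  have hacc := h.acc.transGen
  clear h
  induction hacc with
  | intro a _ ih =>
    obtain ⟨b, hb, hab⟩ := hI a ha
    exact ih b (Relation.transGen_swap.2 hab) hb

/-- Nothing is required of `φ none`, so the exit of an embedded program may be redirected to any
label. This is how programs are composed. -/
theorem MReach.map {L L' : Type} {code : L → Instr (Option L)} {code' : L' → Instr (Option L')}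
    (φ : Option L → Option L')
    (hφ : ∀ l, ∃ l', φ (some l) = some l' ∧ code' l' = (code l).map φ)
    {a b : Option L × (Fin 2 → ℕ)} (h : MReach code a b) :
    MReach code' (φ a.1, a.2) (φ b.1, b.2) := by
  refine Relation.ReflTransGen.lift (fun a : Option L × (Fin 2 → ℕ) => (φ a.1, a.2)) ?_ _ _ h
  rintro a b (⟨l, v, hv⟩ | ⟨l, v, hv⟩) <;> obtain ⟨l', h1, h2⟩ := hφ l
  · have := MStep.zero (code := code') l' v (by rw [h2]; exact hv)
    simpa [Function.onFun, h1, h2, Instr.map] using this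
  · have := MStep.pos (code := code') l' v (by rw [h2]; exact hv)
    rw [h2, ← h1] at this
    exact this

/-- Each pass trades `k + 1` units of one counter for `m` of the other: one self-loop both divides
by `k + 1` and multiplies by `m`. -/
theorem mreach_zero {L : Type} {code : L → Instr (Option L)} {l : L} {k m : ℕ} {e : Option L}
    (h : code l = ⟨0, k, m, some l, e⟩) (n b : ℕ) :
    MReach code (some l, ![n * (k + 1), b]) (e, ![0, b + n * m]) := by
  induction n generalizing b with
  | zero =>
    have := MStep.zero (code := code) l ![0, b] (by simp [h])
    simpa [h] using Relation.ReflTransGen.single this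
  | succ n ih =>
    have := MStep.pos (code := code) l ![(n + 1) * (k + 1), b] (by simp [h]; nlinarith)
    refine Relation.ReflTransGen.head this ?_
    have h2 : (code l).next ![(n + 1) * (k + 1), b] = ![n * (k + 1), b + m] := by
      funext j
      fin_cases j <;> simp [Instr.next, h, add_mul]
    rw [h2, h]
    simpa [add_mul, add_assoc, add_comm m] using ih (b + m)

theorem mreach_one {L : Type} {code : L → Instr (Option L)} {l : L} {k m : ℕ} {e : Option L}
    (h : code l = ⟨1, k, m, some l, e⟩) (n a : ℕ) :
    MReach code (some l, ![a, n * (k + 1)]) (e, ![a + n * m, 0]) := by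
  induction n generalizing a with
  | zero =>
    have := MStep.zero (code := code) l ![a, 0] (by simp [h])
    simpa [h] using Relation.ReflTransGen.single this
  | succ n ih =>
    have := MStep.pos (code := code) l ![a, (n + 1) * (k + 1)] (by simp [h]; nlinarith)
    refine Relation.ReflTransGen.head this ?_
    have h2 : (code l).next ![a, (n + 1) * (k + 1)] = ![a + m, n * (k + 1)] := by
      funext j
      fin_cases j <;> simp [Instr.next, h, add_mul]
    rw [h2, h]
    simpa [add_mul, add_assoc, add_comm m] using ih (a + m)

/-- A flowchart program for two counters. -/
structure Fragment where
  L : Type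
  fin : Fintype L
  entry : L
  code : L → Instr (Option L)

namespace Fragment

/-- Started with `(x, 0)`, the program stops with `(y, 0)`. -/
def Goes (F : Fragment) (x y : ℕ) : Prop :=
  MReach F.code (some F.entry, ![x, 0]) (none, ![y, 0])

def skip : Fragment where
  L := Unit
  fin := inferInstance
  entry := ()
  code _ := ⟨1, 0, 0, none, none⟩

theorem skip_goes (x : ℕ) : skip.Goes x x :=
  Relation.ReflTransGen.single (MStep.zero (code := skip.code) () ![x, 0] rfl)

def mul (p : ℕ) : Fragment where
  L := Bool
  fin := inferInstance
  entry := false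
  code l := match l with
    | false => ⟨0, 0, p, some false, some true⟩
    | true => ⟨1, 0, 1, some true, none⟩

theorem mul_goes (p x : ℕ) : (mul p).Goes x (x * p) := by
  have h1 := mreach_zero (code := (mul p).code) (l := false) rfl x 0
  have h2 := mreach_one (code := (mul p).code) (l := true) rfl (x * p) 0
  simp only [zero_add, mul_one] at h1 h2
  exact h1.trans h2

/-- Relabel along `g` and let the exit lead to `e`. -/
def exitTo {L L' : Type} (e : L') (g : L → L') : Option L → Option L'
  | none => some e
  | some l => some (g l)

def seq (F G : Fragment) : Fragment where
  L := F.L ⊕ G.L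
  fin := have := F.fin; have := G.fin; inferInstance
  entry := .inl F.entry
  code l := match l with
    | .inl l => (F.code l).map (exitTo (.inr G.entry) .inl)
    | .inr l => (G.code l).map (Option.map .inr)

theorem seq_goes {F G : Fragment} {x y z : ℕ} (hF : F.Goes x y) (hG : G.Goes y z) :
    (F.seq G).Goes x z := by
  have h1 := MReach.map (code' := (F.seq G).code) (exitTo (.inr G.entry) .inl)
    (fun l => ⟨.inl l, rfl, rfl⟩) hF
  have h2 := MReach.map (code' := (F.seq G).code) (Option.map .inr)
    (fun l => ⟨.inr l, rfl, rfl⟩) hG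
  exact h1.trans h2

/-- While the first counter is divisible by `q + 1`, divide it by `q + 1` and execute `F`. -/
def loop (q : ℕ) (F : Fragment) : Fragment where
  L := Fin (q + 1) ⊕ Bool ⊕ F.L
  fin := have := F.fin; inferInstance
  entry := .inl 0
  code l := match l with
    | .inl j => ⟨0, 0, 1, some (.inl (j + 1)), some (.inr (.inl (decide (j = 0))))⟩
    | .inr (.inl false) => ⟨1, 0, 1, some (.inr (.inl false)), none⟩
    | .inr (.inl true) => ⟨1, q, 1, some (.inr (.inl true)), some (.inr (.inr F.entry))⟩
    | .inr (.inr l) => (F.code l).map (exitTo (.inl 0) fun l => .inr (.inr l))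

/-- While the first counter is emptied into the second, the control state records the number of
units moved modulo `q + 1`. At the end it knows whether the value is divisible; the label `false`
then restores the value, and `true` brings back the quotient. -/
theorem loop_scan (q : ℕ) (F : Fragment) (n a b : ℕ) :
    MReach (loop q F).code (some (.inl (Fin.ofNat (q + 1) a)), ![n, b])
      (some (.inr (.inl (decide (Fin.ofNat (q + 1) (a + n) = 0)))), ![0, b + n]) := by
  induction n generalizing a b with
  | zero =>
    exact Relation.ReflTransGen.single
      (MStep.zero (code := (loop q F).code) (.inl (Fin.ofNat (q + 1) a)) ![0, b] rfl)
  | succ n ih =>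
    have := MStep.pos (code := (loop q F).code) (.inl (Fin.ofNat (q + 1) a)) ![n + 1, b]
      (Nat.succ_pos n)
    refine Relation.ReflTransGen.head this ?_
    have h2 : ((loop q F).code (.inl (Fin.ofNat (q + 1) a))).next ![n + 1, b] = ![n, b + 1] := by
      funext j
      fin_cases j <;> simp [Instr.next, loop]
    rw [h2]
    have h3 := ih (a + 1) (b + 1)
    rw [add_right_comm, add_assoc a, add_right_comm, add_assoc b] at h3
    have h4 : Fin.ofNat (q + 1) (a + 1) = Fin.ofNat (q + 1) a + 1 := by
      ext
      simp [Fin.val_add]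
    rw [h4] at h3
    exact h3

theorem ofNat_eq_zero_iff (q x : ℕ) : Fin.ofNat (q + 1) x = 0 ↔ (q + 1) ∣ x := by
  rw [Fin.ext_iff, Nat.dvd_iff_mod_eq_zero]
  rfl

theorem loop_exit {q x : ℕ} (F : Fragment) (hx : ¬ (q + 1) ∣ x) : (loop q F).Goes x x := by
  have h1 := loop_scan q F x 0 0
  have h2 := mreach_one (code := (loop q F).code) (l := .inr (.inl false)) rfl x 0
  rw [zero_add, decide_eq_false (by rwa [ofNat_eq_zero_iff])] at h1
  simp only [zero_add, mul_one] at h1 h2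
  exact h1.trans h2

theorem loop_again {q x y : ℕ} {F : Fragment} (hF : F.Goes x y) :
    MReach (loop q F).code (some (loop q F).entry, ![x * (q + 1), 0])
      (some (loop q F).entry, ![y, 0]) := by
  have h1 := loop_scan q F (x * (q + 1)) 0 0
  have h2 := mreach_one (code := (loop q F).code) (l := .inr (.inl true)) rfl x 0
  rw [zero_add, decide_eq_true (by rw [ofNat_eq_zero_iff]; exact Dvd.intro_left x rfl)] at h1
  have h3 := MReach.map (code' := (loop q F).code)
    (exitTo (.inl 0) fun l => .inr (.inr l)) (fun l => ⟨.inr (.inr l), rfl, rfl⟩) hF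
  simp only [zero_add, mul_one] at h1 h2
  exact (h1.trans h2).trans h3

end Fragment

/-! ### Registers as exponents of primes -/

/-- The number `x` stores `s r` as the exponent of the `r`-th prime, for all `r`. -/
def Enc (x : ℕ) (s : ℕ → ℕ) : Prop :=
  x ≠ 0 ∧ ∀ r, x.factorization (Nat.nth Nat.Prime r) = s r

theorem prime_nth (r : ℕ) : (Nat.nth Nat.Prime r).Prime := Nat.prime_nth_prime r

theorem Enc.inc {x : ℕ} {s : ℕ → ℕ} (h : Enc x s) (r : ℕ) :
    Enc (x * Nat.nth Nat.Prime r) (Function.update s r (s r + 1)) := by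
  refine ⟨mul_ne_zero h.1 (prime_nth r).ne_zero, fun r' => ?_⟩
  rw [Nat.factorization_mul h.1 (prime_nth r).ne_zero, (prime_nth r).factorization]
  by_cases hr : r' = r
  · subst hr
    simp [h.2]
  · have : Nat.nth Nat.Prime r ≠ Nat.nth Nat.Prime r' := fun he =>
      hr (Nat.nth_injective Nat.infinite_setOfPred_prime he).symm
    simp [h.2, hr, this]

theorem Enc.dvd_iff {x : ℕ} {s : ℕ → ℕ} (h : Enc x s) (r : ℕ) :
    Nat.nth Nat.Prime r ∣ x ↔ s r ≠ 0 := by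
  rw [← h.2, (prime_nth r).dvd_iff_one_le_factorization h.1, Nat.one_le_iff_ne_zero]

theorem Enc.dec {x : ℕ} {s : ℕ → ℕ} {r k : ℕ} (h : Enc x s) (hr : s r = k + 1) :
    ∃ y, x = y * Nat.nth Nat.Prime r ∧ Enc y (Function.update s r k) := by
  obtain ⟨y, rfl⟩ := (h.dvd_iff r).2 (by omega)
  have hy : y ≠ 0 := fun h0 => h.1 (by simp [h0])
  refine ⟨y, mul_comm _ _, hy, fun r' => ?_⟩
  have := h.2 r'
  rw [Nat.factorization_mul (prime_nth r).ne_zero hy, (prime_nth r).factorization] at this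
  by_cases hr' : r' = r
  · subst hr'
    simp at this ⊢
    omega
  · have hne : Nat.nth Nat.Prime r ≠ Nat.nth Nat.Prime r' := fun he =>
      hr' (Nat.nth_injective Nat.infinite_setOfPred_prime he).symm
    simpa [hr', hne] using this

/-! ### While programs on registers -/

namespace Fragment

/-- Started with registers `s`, the program stops with registers `t`. -/
def Computes (F : Fragment) (s t : ℕ → ℕ) : Prop :=
  ∀ x, Enc x s → ∃ y, Enc y t ∧ F.Goes x y

noncomputable def inc (r : ℕ) : Fragment := mul (Nat.nth Nat.Prime r)

/-- While register `r` is nonzero, decrement it and execute `F`. -/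
noncomputable def whilePos (r : ℕ) (F : Fragment) : Fragment := loop (Nat.nth Nat.Prime r - 1) F

variable {F G : Fragment} {s t u : ℕ → ℕ} {r : ℕ}

theorem Computes.congr {t' : ℕ → ℕ} (hF : F.Computes s t) (h : t = t') : F.Computes s t' := h ▸ hF

theorem skip_computes (s : ℕ → ℕ) : skip.Computes s s := fun x hx => ⟨x, hx, skip_goes x⟩

theorem inc_computes (r : ℕ) (s : ℕ → ℕ) :
    (inc r).Computes s (Function.update s r (s r + 1)) :=
  fun x hx => ⟨_, hx.inc r, mul_goes _ x⟩

theorem Computes.seq (hF : F.Computes s t) (hG : G.Computes t u) : (F.seq G).Computes s u := by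
  intro x hx
  obtain ⟨y, hy, hxy⟩ := hF x hx
  obtain ⟨z, hz, hyz⟩ := hG y hy
  exact ⟨z, hz, seq_goes hxy hyz⟩

theorem nth_prime_sub (r : ℕ) : Nat.nth Nat.Prime r - 1 + 1 = Nat.nth Nat.Prime r :=
  Nat.sub_add_cancel (prime_nth r).one_le

theorem whilePos_computes_zero (F : Fragment) (hr : s r = 0) : (F.whilePos r).Computes s s :=
  fun x hx => ⟨x, hx, loop_exit F (by rw [nth_prime_sub, hx.dvd_iff]; simpa using hr)⟩

/-- One round, stated without assuming that the loop ends: the unbounded search needs it also for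
runs that never stop. -/
theorem Computes.whilePos_again {k : ℕ} (hr : s r = k + 1)
    (hF : F.Computes (Function.update s r k) t) {x : ℕ} (hx : Enc x s) :
    ∃ y, Enc y t ∧ MReach (F.whilePos r).code (some (F.whilePos r).entry, ![x, 0])
      (some (F.whilePos r).entry, ![y, 0]) := by
  obtain ⟨x', rfl, hx'⟩ := hx.dec hr
  obtain ⟨y, hy, hxy⟩ := hF x' hx'
  have := loop_again (q := Nat.nth Nat.Prime r - 1) hxy
  rw [nth_prime_sub] at this
  exact ⟨y, hy, this⟩

theorem Computes.whilePos_succ {k : ℕ} (hr : s r = k + 1)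
    (hF : F.Computes (Function.update s r k) t) (hW : (F.whilePos r).Computes t u) :
    (F.whilePos r).Computes s u := by
  intro x hx
  obtain ⟨y, hy, hxy⟩ := hF.whilePos_again hr hx
  obtain ⟨z, hz, hyz⟩ := hW y hy
  exact ⟨z, hz, hxy.trans hyz⟩

end Fragment

/-! ### Primitive recursive functions -/

namespace Fragment

open Function

variable {s : ℕ → ℕ}

theorem whilePos_skip_computes (s : ℕ → ℕ) (a : ℕ) :
    (skip.whilePos a).Computes s (update s a 0) := by
  generalize hn : s a = n
  induction n generalizing s with
  | zero =>
    have := whilePos_computes_zero skip hn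
    rwa [← hn, update_eq_self]
  | succ n ih =>
    refine (skip_computes _).whilePos_succ hn ?_
    have := ih (update s a n) (by simp)
    rwa [update_idem] at this

theorem whilePos_inc_computes {a b : ℕ} (hab : a ≠ b) (s : ℕ → ℕ) :
    ((inc b).whilePos a).Computes s (update (update s a 0) b (s b + s a)) := by
  generalize hn : s a = n
  induction n generalizing s with
  | zero =>
    have := whilePos_computes_zero (inc b) hn
    rwa [← hn, update_eq_self, hn, add_zero, update_eq_self]
  | succ n ih =>
    refine (inc_computes b _).whilePos_succ hn ?_
    have := ih (update (update s a n) b (update s a n b + 1)) (by simp [hab])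
    convert this using 1
    funext r
    simp only [update_apply]
    grind

/-- Add register `a` to register `b`, with the auxiliary register `c`. -/
noncomputable def copy (a b c : ℕ) : Fragment :=
  (((inc b).seq (inc c)).whilePos a).seq ((inc a).whilePos c)

theorem copy_computes {a b c : ℕ} (hab : a ≠ b) (hac : a ≠ c) (hbc : b ≠ c) (s : ℕ → ℕ)
    (hc : s c = 0) : (copy a b c).Computes s (update s b (s b + s a)) := by
  have h1 : ∀ n s, s a = n → (((inc b).seq (inc c)).whilePos a).Computes s
      (update (update (update s a 0) b (s b + n)) c (s c + n)) := by
    intro n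
    induction n with
    | zero =>
      intro s hn
      have := whilePos_computes_zero ((inc b).seq (inc c)) hn
      convert this using 1
      funext r
      simp only [update_apply]
      grind
    | succ n ih =>
      intro s hn
      refine ((inc_computes b _).seq (inc_computes c _)).whilePos_succ hn ?_
      convert ih _ ?_ using 1
      · funext r
        simp only [update_apply]
        grind
      · simp [update_apply, hab, hac]
  refine ((h1 _ s rfl).seq (whilePos_inc_computes hac.symm _)).congr ?_
  funext r
  simp only [update_apply]
  grind

/-- `f` can be computed with the registers from `k` on as auxiliary registers. -/
def Implementable {n : ℕ} (f : List.Vector ℕ n → ℕ) : Prop :=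
  ∀ (k : ℕ) (inp : Fin n → ℕ) (out : ℕ), (∀ i, inp i < k) → out < k → (∀ i, inp i ≠ out) →
    ∃ F : Fragment, ∀ s : ℕ → ℕ, (∀ r ≥ k, s r = 0) → s out = 0 →
      F.Computes s (update s out (f (List.Vector.ofFn fun i => s (inp i))))

theorem implementable_zero : Implementable (n := 0) fun _ => 0 := by
  intro k inp out _ _ _
  refine ⟨skip, fun s _ h => ?_⟩
  refine (skip_computes s).congr ?_
  simp [← h]

theorem implementable_get {n : ℕ} (i : Fin n) : Implementable fun v => v.get i := by
  intro k inp out hk ho hne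
  refine ⟨copy (inp i) out k, fun s hs h => ?_⟩
  refine (copy_computes (hne i) (hk i).ne ho.ne s (hs k le_rfl)).congr ?_
  simp [h]

theorem implementable_succ : Implementable (n := 1) fun v => v.head.succ := by
  intro k inp out hk ho hne
  refine ⟨(copy (inp 0) out k).seq (inc out), fun s hs h => ?_⟩
  refine ((copy_computes (hne 0) (hk 0).ne ho.ne s (hs k le_rfl)).seq (inc_computes _ _)).congr ?_
  funext r
  simp [h, List.Vector.ofFn]

/-- Implementations must leave the auxiliary registers at zero, so that they can be chained and
repeated. -/
theorem exists_clear (k m : ℕ) :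
    ∃ F : Fragment, ∀ s : ℕ → ℕ, F.Computes s fun r => if k ≤ r ∧ r < k + m then 0 else s r := by
  induction m with
  | zero =>
    refine ⟨skip, fun s => (skip_computes s).congr ?_⟩
    funext r
    grind
  | succ m ih =>
    obtain ⟨F, hF⟩ := ih
    refine ⟨F.seq (skip.whilePos (k + m)), fun s =>
      ((hF s).seq (whilePos_skip_computes _ _)).congr ?_⟩
    funext r
    simp only [update_apply]
    grind

/-- The values of the `g i` go into the registers `k, …, k + m - 1`, the subprograms use auxiliary
registers from `k + m` on, and the intermediate values are cleared at the end. -/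
theorem implementable_comp {m n : ℕ} {f : List.Vector ℕ m → ℕ}
    (g : Fin m → List.Vector ℕ n → ℕ) (hf : Implementable f) (hg : ∀ i, Implementable (g i)) :
    Implementable fun a => f (List.Vector.ofFn fun i => g i a) := by
  intro k inp out hk ho hne
  let val : (ℕ → ℕ) → ℕ → ℕ := fun s i =>
    if h : i < m then g ⟨i, h⟩ (List.Vector.ofFn fun i => s (inp i)) else 0
  have hG : ∀ j ≤ m, ∃ F : Fragment, ∀ s : ℕ → ℕ, (∀ r ≥ k, s r = 0) →
      F.Computes s fun r => if k ≤ r ∧ r < k + j then val s (r - k) else s r := by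
    intro j
    induction j with
    | zero =>
      refine fun _ => ⟨skip, fun s _ => (skip_computes s).congr ?_⟩
      funext r
      grind
    | succ j ih =>
      intro hj
      obtain ⟨F, hF⟩ := ih (by omega)
      obtain ⟨G, hG⟩ := hg ⟨j, hj⟩ (k + m) inp (k + j) (fun i => (hk i).trans_le (by omega))
        (by omega) (fun i => by have := hk i; omega)
      refine ⟨F.seq G, fun s hs => ((hF s hs).seq (hG _ ?_ ?_)).congr ?_⟩
      · intro r hr
        rw [if_neg (by omega)]
        exact hs r (by omega)
      · rw [if_neg (by omega)]
        exact hs _ (by omega)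
      · have hin : (List.Vector.ofFn fun i => if k ≤ inp i ∧ inp i < k + j then
            val s (inp i - k) else s (inp i)) = List.Vector.ofFn fun i => s (inp i) := by
          congr 1
          funext i
          rw [if_neg (by have := hk i; omega)]
        funext r
        simp only [update_apply]
        rw [hin]
        by_cases hr : r = k + j
        · subst hr
          simp [val, show j < m from hj]
        · rw [if_neg hr]
          congr 1
          exact propext (by omega)
  obtain ⟨G, hG⟩ := hG m le_rfl
  obtain ⟨F, hF⟩ := hf (k + m) (fun i => k + i) out (fun i => by omega) (by omega)
    (fun i => by omega)
  obtain ⟨K, hK⟩ := exists_clear k m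
  refine ⟨(G.seq F).seq K, fun s hs h => (((hG s hs).seq (hF _ ?_ ?_)).seq (hK _)).congr ?_⟩
  · intro r hr
    rw [if_neg (by omega)]
    exact hs r (by omega)
  · rw [if_neg (by omega), h]
  · have hin : (List.Vector.ofFn fun i : Fin m => if k ≤ k + (i : ℕ) ∧ k + (i : ℕ) < k + m then
        val s (k + i - k) else s (k + i)) =
        List.Vector.ofFn fun i => g i (List.Vector.ofFn fun i => s (inp i)) := by
      congr 1
      funext i
      rw [if_pos (by omega)]
      simp [val]
    rw [hin]
    funext r
    have := hs r
    simp only [update_apply]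
    grind

/-- The recursion is a counted loop: register `k` holds the rounds left, `k + 1` the index, `k + 2`
the previous value during a round, and `out` the current value. -/
theorem implementable_prec {n : ℕ} {f : List.Vector ℕ n → ℕ} {g : List.Vector ℕ (n + 2) → ℕ}
    (hf : Implementable f) (hg : Implementable g) :
    Implementable fun v : List.Vector ℕ (n + 1) =>
      v.head.rec (f v.tail) fun y IH => g (y ::ᵥ IH ::ᵥ v.tail) := by
  intro k inp out hk ho hne
  obtain ⟨F, hF⟩ := hf (k + 3) (fun i => inp i.succ) out (fun i => (hk _).trans_le (by omega))
    (by omega) (fun i => hne _)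
  obtain ⟨G, hG⟩ := hg (k + 3) (Fin.cons (k + 1) (Fin.cons (k + 2) fun i => inp i.succ)) out
    (by
      intro i
      refine Fin.cases (by simp) (fun i => Fin.cases (by simp) (fun i => ?_) i) i
      simpa using (hk _).trans_le (by omega))
    (by omega)
    (by
      intro i
      refine Fin.cases ?_ (fun i => Fin.cases ?_ (fun i => ?_) i) i
      · simp; omega
      · simp; omega
      · simpa using hne _)
  let B : Fragment := (((inc (k + 2)).whilePos out).seq G).seq
    ((skip.whilePos (k + 2)).seq (inc (k + 1)))
  refine ⟨(F.seq (copy (inp 0) k (k + 1))).seq ((B.whilePos k).seq (skip.whilePos (k + 1))),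
    fun s hs h => ?_⟩
  let w := List.Vector.ofFn fun i => s (inp i.succ)
  let R : ℕ → ℕ := fun j => Nat.rec (f w) (fun y IH => g (y ::ᵥ IH ::ᵥ w)) j
  -- The loop invariant: `d` rounds remain and the value at index `j` has been computed.
  let T : ℕ → ℕ → ℕ → ℕ := fun d j r =>
    if r = out then R j else if r = k then d else if r = k + 1 then j else s r
  have hB : ∀ d j, B.Computes (T d j) (T d (j + 1)) := by
    intro d j
    refine (((whilePos_inc_computes (by omega) _).seq (hG _ ?_ ?_)).seq
      ((whilePos_skip_computes _ _).seq (inc_computes _ _))).congr ?_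
    · intro r hr
      have := hs r
      simp only [update_apply, T]
      grind
    · simp only [update_apply, T]
      grind
    · have hin : List.Vector.ofFn (fun i => update (update (T d j) out 0) (k + 2)
          (T d j (k + 2) + T d j out) ((Fin.cons (k + 1) (Fin.cons (k + 2) fun i => inp i.succ) :
            Fin (n + 2) → ℕ) i)) = j ::ᵥ R j ::ᵥ w := by
        have hs2 := hs (k + 2)
        change _ ::ᵥ _ ::ᵥ List.Vector.ofFn _ = _
        congr 1
        · simp only [update_apply, T, Fin.cons_zero]
          grind
        · congr 1
          · simp only [update_apply, T, Fin.cons_zero, Fin.cons_succ]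
            grind
          · congr 1
            funext i
            have h1 := hk i.succ
            have h2 := hne i.succ
            simp only [update_apply, T, Fin.cons_succ]
            grind
      rw [hin]
      have hR : g (j ::ᵥ R j ::ᵥ w) = R (j + 1) := rfl
      rw [hR]
      have hs2 := hs (k + 2)
      funext r
      simp only [update_apply, T]
      grind
  have hloop : ∀ d j, (B.whilePos k).Computes (T d j) (T 0 (j + d)) := by
    intro d
    induction d with
    | zero =>
      intro j
      exact whilePos_computes_zero B (by simp only [T]; grind)
    | succ d ih =>
      intro j
      have hT : update (T (d + 1) j) k d = T d j := by
        funext r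
        simp only [update_apply, T]
        grind
      refine Computes.whilePos_succ (k := d) (by simp only [T]; grind) (by rw [hT]; exact hB d j) ?_
      have := ih (j + 1)
      rwa [add_right_comm, add_assoc] at this
  have hw : (List.Vector.ofFn fun i => s (inp i)) = s (inp 0) ::ᵥ w := rfl
  have hk0 := hk 0
  have hne0 := hne 0
  have hsk := hs k le_rfl
  have hsk1 := hs (k + 1) (by omega)
  have h1 := (hF s (fun r hr => hs r (by omega)) h).seq
    (copy_computes (a := inp 0) (b := k) (c := k + 1) (by omega) (by omega) (by omega) _
      (by simp only [update_apply]; grind))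
  have hT0 : update (update s out (R 0)) k
      (update s out (R 0) k + update s out (R 0) (inp 0)) = T (s (inp 0)) 0 := by
    funext r
    simp only [update_apply, T]
    grind
  change Computes _ _ (update (update s out (R 0)) k
    (update s out (R 0) k + update s out (R 0) (inp 0))) at h1
  rw [hT0] at h1
  refine (h1.seq ((hloop _ 0).seq (whilePos_skip_computes _ _))).congr ?_
  rw [hw, zero_add]
  change _ = update s out (R (s (inp 0)))
  funext r
  simp only [update_apply, T]
  grind

theorem _root_.Nat.Primrec'.implementable {n : ℕ} {f : List.Vector ℕ n → ℕ}
    (hf : Nat.Primrec' f) : Implementable f := by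
  induction hf with
  | zero => exact implementable_zero
  | succ => exact implementable_succ
  | get i => exact implementable_get i
  | comp g _ _ hf hg => exact implementable_comp g hf hg
  | prec _ _ hf hg => exact implementable_prec hf hg

end Fragment

/-! ### A two-counter machine with an undecidable halting problem -/

open Function

theorem enc_one : Enc 1 fun _ => 0 := ⟨one_ne_zero, by simp⟩

/-- The registers of the search for a zero of `g (n, ·)`. -/
def searchState (n fl t : ℕ) : ℕ → ℕ :=
  fun r => if r = 0 then n else if r = 1 then fl else if r = 2 then t else 0

/-- The initial value of the first counter for the input `n`. -/
noncomputable def startValue (n : ℕ) : ℕ := Nat.nth Nat.Prime 0 ^ n * Nat.nth Nat.Prime 1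

theorem enc_startValue (n : ℕ) : Enc (startValue n) (searchState n 1 0) := by
  have h : ∀ n, Enc (Nat.nth Nat.Prime 0 ^ n) (searchState n 0 0) := by
    intro n
    induction n with
    | zero =>
      have h0 : searchState 0 0 0 = fun _ => 0 := by
        funext r
        simp [searchState]
      rw [h0, pow_zero]
      exact enc_one
    | succ n ih =>
      have h1 : searchState (n + 1) 0 0 =
          update (searchState n 0 0) 0 (searchState n 0 0 0 + 1) := by
        funext r
        simp only [searchState, update_apply]
        grind
      rw [h1, pow_succ]
      exact ih.inc 0
  have h1 : searchState n 1 0 = update (searchState n 0 0) 1 (searchState n 0 0 1 + 1) := by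
    funext r
    simp only [searchState, update_apply]
    grind
  rw [h1]
  exact (h n).inc 1

/-- Only two fixed primes occur, so they enter as constants and no prime has to be computed. -/
theorem computable_startValue : Computable startValue := by
  have h : Primrec fun n : ℕ =>
      (Nat.rec 1 (fun _ y => y * Nat.nth Nat.Prime 0) n : ℕ) * Nat.nth Nat.Prime 1 := by
    refine Primrec.nat_mul.comp (Primrec.nat_rec₁ 1 ?_) (Primrec.const _)
    exact Primrec.nat_mul.comp Primrec.snd (Primrec.const _)
  refine (h.of_eq fun n => ?_).to_comp
  unfold startValue
  congr 1
  induction n with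
  | zero => rfl
  | succ n ih => rw [pow_succ, ← ih]

namespace Fragment

/-- Register 1 holds the last value of `g n`, and the loop runs while it is nonzero. It starts at 1
so that the first test takes place. -/
theorem exists_search (g : ℕ → ℕ → ℕ) (hg : Primrec₂ g) :
    ∃ F : Fragment, ∀ n, (∃ w, MReach F.code (some F.entry, ![startValue n, 0]) (none, w)) ↔
      ∃ t, g n t = 0 := by
  obtain ⟨G, hG⟩ := (Nat.Primrec'.prim_iff₂.2 hg).implementable 3 ![0, 2] 1
    (by intro i; fin_cases i <;> simp) (by omega) (by intro i; fin_cases i <;> simp)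
  let B : Fragment := ((skip.whilePos 1).seq G).seq (inc 2)
  have hB : ∀ n fl t, B.Computes (searchState n fl t) (searchState n (g n t) (t + 1)) := by
    intro n fl t
    refine (((whilePos_skip_computes _ _).seq (hG _ ?_ ?_)).seq (inc_computes _ _)).congr ?_
    · intro r hr
      simp only [searchState, update_apply]
      grind
    · simp
    · have h0 : (fun v : List.Vector ℕ 2 => g v.head v.tail.head) (List.Vector.ofFn fun i : Fin 2 =>
          update (searchState n fl t) 1 0 (![0, 2] i)) = g n t := rfl
      rw [h0]
      funext r
      simp only [searchState, update_apply]
      grind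
  have hdec : ∀ n k t, update (searchState n (k + 1) t) 1 k = searchState n k t := by
    intro n k t
    funext r
    simp only [searchState, update_apply]
    grind
  have again : ∀ n k t x, Enc x (searchState n (k + 1) t) →
      ∃ y, Enc y (searchState n (g n t) (t + 1)) ∧
        MReach (B.whilePos 1).code (some (B.whilePos 1).entry, ![x, 0])
          (some (B.whilePos 1).entry, ![y, 0]) :=
    fun n k t x hx => Computes.whilePos_again (s := searchState n (k + 1) t) (k := k) rfl
      (by rw [hdec]; exact hB n k t) hx
  refine ⟨B.whilePos 1, fun n => ⟨?_, ?_⟩⟩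
  · rintro ⟨w, hw⟩
    by_contra! hne
    refine not_mreach_none {a | ∃ x k t, Enc x (searchState n (k + 1) t) ∧
      a = (some (B.whilePos 1).entry, ![x, 0])} ?_ ⟨_, 0, 0, enc_startValue n, rfl⟩ w hw
    rintro _ ⟨x, k, t, hx, rfl⟩
    obtain ⟨y, hy, hxy⟩ := again n k t x hx
    obtain ⟨k', hk'⟩ := Nat.exists_eq_succ_of_ne_zero (hne t)
    refine ⟨_, ⟨y, k', t + 1, by rwa [hk'] at hy, rfl⟩, ?_⟩
    -- A round makes at least one step, because it changes register 2 and hence the first counter.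
    refine (Relation.reflTransGen_iff_eq_or_transGen.1 hxy).resolve_left fun he => ?_
    have hyx : y = x := by simpa using congrArg (fun a => a.2 0) he
    subst hyx
    have h1 := hx.2 2
    rw [hy.2 2] at h1
    simp [searchState] at h1
  · rintro ⟨t, ht⟩
    -- Induction on the distance `d` to a known zero. The flag `fl` is arbitrary because the loop
    -- may stop at an earlier zero.
    have key : ∀ d t fl x, g n (t + d) = 0 → Enc x (searchState n fl t) →
        ∃ w, MReach (B.whilePos 1).code (some (B.whilePos 1).entry, ![x, 0]) (none, w) := by
      have exits : ∀ t x, Enc x (searchState n 0 t) →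
          ∃ w, MReach (B.whilePos 1).code (some (B.whilePos 1).entry, ![x, 0]) (none, w) := by
        intro t x hx
        obtain ⟨y, -, hy⟩ := whilePos_computes_zero (r := 1) B rfl x hx
        exact ⟨_, hy⟩
      intro d
      induction d with
      | zero =>
        intro t fl x hd hx
        cases fl with
        | zero => exact exits t x hx
        | succ k =>
          obtain ⟨y, hy, hxy⟩ := again n k t x hx
          rw [add_zero] at hd
          rw [hd] at hy
          obtain ⟨w, hw⟩ := exits _ y hy
          exact ⟨w, hxy.trans hw⟩
      | succ d ih =>
        intro t fl x hd hx
        cases fl with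
        | zero => exact exits t x hx
        | succ k =>
          obtain ⟨y, hy, hxy⟩ := again n k t x hx
          obtain ⟨w, hw⟩ := ih (t + 1) _ y (by rwa [add_right_comm]) hy
          exact ⟨w, hxy.trans hw⟩
    exact key t 0 1 _ (by rwa [zero_add]) (enc_startValue n)

theorem exists_universal :
    ∃ F : Fragment, ∀ c : Nat.Partrec.Code,
      (∃ w, MReach F.code (some F.entry, ![startValue (Encodable.encode c), 0]) (none, w)) ↔
        (c.eval 0).Dom := by
  -- Zero exactly when the code numbered `n` halts on input 0 within the bound `t`; the default 1
  -- keeps the search running.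
  let g : ℕ → ℕ → ℕ := fun n t =>
    ((Nat.Partrec.Code.evaln t (Denumerable.ofNat Nat.Partrec.Code n) 0).map fun _ => 0).getD 1
  have hg : Primrec₂ g := by
    refine Primrec.option_getD.comp (Primrec.option_map ?_ (Primrec.const 0).to₂) (Primrec.const 1)
    exact Nat.Partrec.Code.primrec_evaln.comp
      ((Primrec.snd.pair ((Primrec.ofNat _).comp Primrec.fst)).pair (Primrec.const 0))
  obtain ⟨F, hF⟩ := exists_search g hg
  refine ⟨F, fun c => ?_⟩
  rw [hF, Part.dom_iff_mem]
  simp only [g, Denumerable.ofNat_encode, Nat.Partrec.Code.evaln_complete]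
  rw [exists_comm]
  refine exists_congr fun t => ?_
  cases Nat.Partrec.Code.evaln t c 0 <;> simp

end Fragment

/-! ### The game that simulates a two-counter machine -/

theorem MDP.exists_step_of_mem_plays {C : Type} {M : MDP C} {c₀ : C} {σ : M.Strategy}
    {ω : ℕ → Option C} (hω : ω ∈ M.plays c₀ σ) {n : ℕ} {c : C} (hc : ω n = some c)
    (hD : ∃ c', M.step c c') : ∃ c', M.step c c' ∧ ω (n + 1) = some c' := by
  by_cases hP : c ∈ M.player1
  · exact ⟨_, step_of_mem_plays hω n c hc hP (not_not.2 hD), ((hω.2 n).2 c hc).2.1 (not_not.2 hD) hP⟩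
  · exact ((hω.2 n).2 c hc).2.2 (not_not.2 hD) hP

/-- The control states: `ctl a` belongs to Player 1, who claims at `ctl (some l)` that the counter
tested by the instruction `l` is positive (`pos l`) or zero (`zero l`). -/
inductive GState (L : Type) : Type
  | ctl (a : Option L)
  | pos (l : L)
  | zero (l : L)
  | sink

namespace GState

variable {L : Type}

instance [Finite L] : Finite (GState L) := by
  refine Finite.of_surjective (α := Option L ⊕ L ⊕ L ⊕ Unit) (fun x => match x with
    | .inl a => ctl a
    | .inr (.inl l) => pos l
    | .inr (.inr (.inl l)) => zero l
    | .inr (.inr (.inr _)) => sink) ?_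
  rintro (a | l | l | _)
  · exact ⟨.inl a, rfl⟩
  · exact ⟨.inr (.inl l), rfl⟩
  · exact ⟨.inr (.inr (.inl l)), rfl⟩
  · exact ⟨.inr (.inr (.inr ())), rfl⟩

/-- The label of the simulated machine. -/
def label : GState L → Option (Option L)
  | ctl a => some a
  | pos l => some (some l)
  | zero l => some (some l)
  | sink => none

end GState

open GState

/-- The effect of the nonzero branch of an instruction. -/
def Instr.effect {E : Type} (I : Instr E) : Fin 2 → ℤ :=
  fun j => if j = I.i then -((I.k : ℤ) + 1) else I.m

variable {L : Type} (code : L → Instr (Option L)) {k : ℕ} (e : GState L ≃ Fin k)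

/-- The transitions that leave a control state. -/
def gameMoves : GState L → List ((Fin 2 → ℤ) × GState L)
  | ctl none => [(0, ctl none)]
  | ctl (some l) => [(0, pos l), (0, zero l)]
  | pos l => [((code l).effect, ctl (code l).t)]
  | zero l => [(0, ctl (code l).t'), (-Pi.single (code l).i 1, sink)]
  | sink => []

open Classical in
/-- The P-VASS-MDP that simulates a two-counter machine. -/
noncomputable def gameVASS : VASSMDP (Fin k) 2 where
  Q₁ := Finset.univ.filter fun q => ∃ a, e.symm q = ctl a
  T := Finset.univ.biUnion fun q : Fin k =>
    ((gameMoves code (e.symm q)).map fun p => (q, p.1, e p.2)).toFinset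
  τ _ := 1

theorem mem_gameVASS_T {t : Transition (Fin k) 2} : t ∈ (gameVASS code e).T ↔
    ∃ p ∈ gameMoves code (e.symm t.1), t = (t.1, p.1, e p.2) := by
  simp only [gameVASS, Finset.mem_biUnion, Finset.mem_univ, true_and, List.mem_toFinset,
    List.mem_map]
  constructor
  · rintro ⟨q, p, hp, rfl⟩
    exact ⟨p, hp, rfl⟩
  · rintro ⟨p, hp, h⟩
    exact ⟨_, p, hp, h.symm⟩

theorem gameVASS_isPVASSMDP : (gameVASS code e).IsPVASSMDP := by
  intro t ht h1
  obtain ⟨p, hp, h⟩ := (mem_gameVASS_T code e).1 ht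
  obtain ⟨a, ha⟩ : ∃ a, e.symm t.1 = ctl a := by simpa [gameVASS] using h1
  have hz : t.2.1 = p.1 := by rw [h]
  rw [hz]
  rw [ha] at hp
  cases a with
  | none => simp only [gameMoves, List.mem_singleton] at hp; rw [hp]
  | some l =>
    simp only [gameMoves, List.mem_cons, List.not_mem_nil, or_false] at hp
    rcases hp with rfl | rfl <;> rfl

/-- The counters after a transition. -/
def shift (v : Fin 2 → ℕ) (z : Fin 2 → ℤ) : Fin 2 → ℕ := fun i => ((v i : ℤ) + z i).toNat

theorem shift_zero (v : Fin 2 → ℕ) : shift v 0 = v := by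
  funext i
  simp [shift]

variable {code e}

theorem gameVASS_step_iff {q : GState L} {v : Fin 2 → ℕ} {c' : Config (Fin k) 2} :
    (gameVASS code e).toMDP.step (e q, v) c' ↔
      ∃ p ∈ gameMoves code q, (∀ i, 0 ≤ (v i : ℤ) + p.1 i) ∧ c' = (e p.2, shift v p.1) := by
  constructor
  · rintro ⟨t, ht, ⟨h1, h2⟩, rfl⟩
    obtain ⟨p, hp, h⟩ := (mem_gameVASS_T code e).1 ht
    rw [h1] at h hp
    rw [Equiv.symm_apply_apply] at hp
    rw [h] at h2 ⊢
    exact ⟨p, hp, h2, rfl⟩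
  · rintro ⟨p, hp, h, rfl⟩
    refine ⟨(e q, p.1, e p.2), (mem_gameVASS_T code e).2 ⟨p, by simpa using hp, rfl⟩, ⟨rfl, h⟩, rfl⟩

theorem gameVASS_mem_player1 {q : GState L} {v : Fin 2 → ℕ} :
    (e q, v) ∈ (gameVASS code e).toMDP.player1 ↔ ∃ a, q = ctl a := by
  change e q ∈ (gameVASS code e).Q₁ ↔ _
  simp [gameVASS]

theorem gameVASS_step_ctl_none {v : Fin 2 → ℕ} {c' : Config (Fin k) 2} :
    (gameVASS code e).toMDP.step (e (ctl none), v) c' ↔ c' = (e (ctl none), v) := by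
  simp [gameVASS_step_iff, gameMoves, shift_zero]

theorem gameVASS_step_ctl_some {l : L} {v : Fin 2 → ℕ} {c' : Config (Fin k) 2} :
    (gameVASS code e).toMDP.step (e (ctl (some l)), v) c' ↔
      c' = (e (pos l), v) ∨ c' = (e (zero l), v) := by
  simp [gameVASS_step_iff, gameMoves, shift_zero]

theorem effect_nonneg_iff {E : Type} {I : Instr E} {v : Fin 2 → ℕ} :
    (∀ i, 0 ≤ (v i : ℤ) + I.effect i) ↔ I.k < v I.i := by
  constructor
  · intro h
    have := h I.i
    simp only [Instr.effect, if_true] at this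
    omega
  · intro h i
    simp only [Instr.effect]
    split_ifs with hi
    · subst hi
      omega
    · positivity

theorem shift_effect {E : Type} {I : Instr E} {v : Fin 2 → ℕ} :
    shift v I.effect = I.next v := by
  funext i
  simp only [shift, Instr.effect, Instr.next]
  split_ifs <;> omega

theorem gameVASS_step_pos {l : L} {v : Fin 2 → ℕ} {c' : Config (Fin k) 2} :
    (gameVASS code e).toMDP.step (e (pos l), v) c' ↔
      (code l).k < v (code l).i ∧ c' = (e (ctl (code l).t), (code l).next v) := by
  rw [gameVASS_step_iff]
  simp only [gameMoves, List.mem_singleton, exists_eq_left, effect_nonneg_iff, shift_effect]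

/-- The decrement into the sink acts as a zero test: it is disabled exactly when the claim is true.
-/
theorem gameVASS_step_zero {l : L} {v : Fin 2 → ℕ} {c' : Config (Fin k) 2} :
    (gameVASS code e).toMDP.step (e (zero l), v) c' ↔
      c' = (e (ctl (code l).t'), v) ∨
      (0 < v (code l).i ∧ c' = (e sink, shift v (-Pi.single (code l).i 1))) := by
  have h : (∀ i, 0 ≤ (v i : ℤ) + (-Pi.single (code l).i 1 : Fin 2 → ℤ) i) ↔
      0 < v (code l).i := by
    constructor
    · intro h
      have := h (code l).i
      simp only [Pi.neg_apply, Pi.single_eq_same] at this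
      omega
    · intro h i
      by_cases hi : i = (code l).i
      · subst hi
        simp only [Pi.neg_apply, Pi.single_eq_same]
        omega
      · simp [hi]
  rw [gameVASS_step_iff]
  simp only [gameMoves, List.mem_cons, List.not_mem_nil, or_false, exists_eq_or_imp,
    exists_eq_left, h, shift_zero]
  simp

theorem gameVASS_not_step_sink {v : Fin 2 → ℕ} {c' : Config (Fin k) 2} :
    ¬ (gameVASS code e).toMDP.step (e sink, v) c' := by
  simp [gameVASS_step_iff, gameMoves]

/-! #### The honest strategy -/

variable (code e) in
def honestMove (c : Config (Fin k) 2) : Config (Fin k) 2 :=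
  match e.symm c.1 with
  | ctl (some l) => if c.2 (code l).i = 0 then (e (zero l), c.2) else (e (pos l), c.2)
  | _ => c

variable (code e) in
/-- Player 1 always claims the truth. -/
noncomputable def honest : (gameVASS code e).toMDP.Strategy where
  -- The default concerns only the empty list, which is not a history.
  choose h := (h.getLast?.map (honestMove code e)).getD (e sink, 0)
  legal := by
    rintro ρ ⟨q, v⟩ - hP -
    obtain ⟨q, rfl⟩ := e.surjective q
    obtain ⟨a, rfl⟩ := gameVASS_mem_player1.1 hP
    rw [List.getLast?_append]
    cases a with
    | none => simp [honestMove, gameVASS_step_ctl_none]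
    | some l =>
      simp only [List.getLast?_singleton, Option.some_or, Option.map_some, Option.getD_some,
        gameVASS_step_ctl_some, honestMove, Equiv.symm_apply_apply]
      split_ifs <;> simp

theorem honest_next {c₀ : Config (Fin k) 2} {ω : ℕ → Option (Config (Fin k) 2)}
    (hω : ω ∈ (gameVASS code e).toMDP.plays c₀ (honest code e)) {n : ℕ} {a : Option L}
    {v : Fin 2 → ℕ} (h : ω n = some (e (ctl a), v)) :
    ω (n + 1) = some (honestMove code e (e (ctl a), v)) := by
  have hD : ¬ (gameVASS code e).toMDP.IsDeadlock (e (ctl a), v) := by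
    refine not_not.2 ?_
    cases a with
    | none => exact ⟨_, gameVASS_step_ctl_none.2 rfl⟩
    | some l => exact ⟨_, gameVASS_step_ctl_some.2 (.inl rfl)⟩
  rw [((hω.2 n).2 _ h).2.1 hD (gameVASS_mem_player1.2 ⟨a, rfl⟩)]
  obtain ⟨ρ, hρ⟩ := MDP.history_eq_of_eq_some h
  rw [hρ]
  simp [honest]

/-- After a true claim Player P has a single enabled move, so two moves of the game reproduce one
machine step with no randomness. -/
theorem honest_step {c₀ : Config (Fin k) 2} {ω : ℕ → Option (Config (Fin k) 2)}
    (hω : ω ∈ (gameVASS code e).toMDP.plays c₀ (honest code e)) {n : ℕ}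
    {a b : Option L × (Fin 2 → ℕ)} (hab : MStep code a b) (h : ω n = some (e (ctl a.1), a.2)) :
    ω (n + 2) = some (e (ctl b.1), b.2) := by
  have h1 := honest_next hω h
  cases hab with
  | zero l v hv =>
    simp only [honestMove, Equiv.symm_apply_apply, hv, if_true] at h1
    obtain ⟨c', hc', h2⟩ := MDP.exists_step_of_mem_plays hω h1 ⟨_, gameVASS_step_zero.2 (.inl rfl)⟩
    rw [gameVASS_step_zero, hv] at hc'
    rw [h2, hc'.resolve_right (by simp)]
  | pos l v hv =>
    simp only [honestMove, Equiv.symm_apply_apply, (Nat.zero_le _).trans_lt hv |>.ne',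
      if_false] at h1
    obtain ⟨c', hc', h2⟩ := MDP.exists_step_of_mem_plays hω h1
      ⟨_, gameVASS_step_pos.2 ⟨hv, rfl⟩⟩
    rw [h2, (gameVASS_step_pos.1 hc').2]

theorem plays_honest_subset {a : Option L × (Fin 2 → ℕ)} {w : Fin 2 → ℕ}
    (h : MReach code a (none, w)) :
    (gameVASS code e).toMDP.plays (e (ctl a.1), a.2) (honest code e) ⊆
      repeatedReach (e (ctl none)) := by
  intro ω hω
  obtain ⟨N, hN⟩ : ∃ N, ω N = some (e (ctl none), w) := by
    have key : ∀ c, MReach code c (none, w) → ∀ n, ω n = some (e (ctl c.1), c.2) →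
        ∃ N, ω N = some (e (ctl none), w) := by
      intro c hc
      induction hc using Relation.ReflTransGen.head_induction_on with
      | refl => exact fun n hn => ⟨n, hn⟩
      | head hab _ ih => exact fun n hn => ih (n + 2) (honest_step hω hab hn)
    exact key a h 0 hω.1
  have hconst : ∀ n ≥ N, ω n = some (e (ctl none), w) := by
    intro n hn
    induction n, hn using Nat.le_induction with
    | base => exact hN
    | succ n _ ih => simpa [honestMove] using honest_next hω ih
  refine ⟨fun i hi => ?_, ?_⟩
  · have : ∀ j, ω (i + j) = none := by
      intro j
      induction j with
      | zero => exact hi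
      | succ j ih => exact (hω.2 (i + j)).1 ih
    simpa [this N] using hconst (i + N) (by omega)
  · exact (Set.Ici_infinite N).mono fun n hn => ⟨w, hconst n hn⟩

/-! #### Cheating is punished -/

open Classical in
variable (code e) in
/-- An upper bound on the probability of reaching the target. -/
noncomputable def gameValue (a₀ : Option L × (Fin 2 → ℕ)) :
    Option (Config (Fin k) 2) → ℝ≥0∞
  | none => 0
  | some c =>
    match (e.symm c.1).label with
    | none => 0
    | some a => if MReach code a₀ (a, c.2) then 2⁻¹ else 1

theorem gameValue_le_one {a₀ : Option L × (Fin 2 → ℕ)} (x : Option (Config (Fin k) 2)) :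
    gameValue code e a₀ x ≤ 1 := by
  rcases x with _ | c
  · simp [gameValue]
  · simp only [gameValue]
    split
    · simp
    · split_ifs <;> simp

theorem gameValue_of_reach {a₀ : Option L × (Fin 2 → ℕ)} {q : GState L} {a : Option L}
    {v : Fin 2 → ℕ} (hq : q.label = some a) (h : MReach code a₀ (a, v)) :
    gameValue code e a₀ (some (e q, v)) = 2⁻¹ := by
  simp [gameValue, hq, h]

theorem gameValue_of_not_reach {a₀ : Option L × (Fin 2 → ℕ)} {q : GState L} {a : Option L}
    {v : Fin 2 → ℕ} (hq : q.label = some a) (h : ¬ MReach code a₀ (a, v)) :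
    gameValue code e a₀ (some (e q, v)) = 1 := by
  simp [gameValue, hq, h]

theorem gameValue_sink {a₀ : Option L × (Fin 2 → ℕ)} {v : Fin 2 → ℕ} :
    gameValue code e a₀ (some (e sink, v)) = 0 := by
  simp [gameValue, label]

theorem tsum_le_of_step {C : Type} (M : MDP C) {c : C} (hP : c ∉ M.player1)
    (hc : ∃ c', M.step c c') (V : C → ℝ≥0∞) (b : ℝ≥0∞) (h : ∀ c', M.step c c' → V c' ≤ b) :
    ∑' c', M.p c hP hc c' * V c' ≤ b := by
  calc ∑' c', M.p c hP hc c' * V c' ≤ ∑' c', M.p c hP hc c' * b := by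
        refine ENNReal.tsum_le_tsum fun c' => ?_
        by_cases hs : M.step c c'
        · exact mul_le_mul_right (h c' hs) _
        · have : M.p c hP hc c' = 0 := by
            simpa using mt (M.p_pos c hP hc c').1 hs
          simp [this]
    _ = b := by rw [ENNReal.tsum_mul_right, PMF.tsum_coe, one_mul]

/-- The move to the sink is enabled and at least as likely as going on, and the two probabilities
add up to at most 1. -/
theorem gameVASS_p_zero_le {l : L} {v : Fin 2 → ℕ} (hv : 0 < v (code l).i) (hP hc) :
    (gameVASS code e).toMDP.p (e (zero l), v) hP hc (e (ctl (code l).t'), v) ≤ 2⁻¹ := by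
  set c : Config (Fin k) 2 := (e (zero l), v)
  set c₁ : Config (Fin k) 2 := (e (ctl (code l).t'), v)
  set c₂ : Config (Fin k) 2 := (e sink, shift v (-Pi.single (code l).i 1))
  have hne : c₁ ≠ c₂ := fun h => by simpa [c₁, c₂] using congrArg Prod.fst h
  have h1 : (gameVASS code e).stepWeight c c₁ ≤ 1 := by
    classical
    unfold VASSMDP.stepWeight
    have hτ : ∀ t, (((gameVASS code e).τ t : ℕ+) : ℕ) = 1 := fun t => rfl
    simp only [hτ, Finset.sum_boole, Nat.cast_id]
    refine Finset.card_le_one.2 fun t ht t' ht' => ?_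
    have key : ∀ t : {t // t ∈ (gameVASS code e).T},
        VASSMDP.Enabled c t.1 ∧ VASSMDP.fire c t.1 = c₁ →
          t.1 = (e (zero l), 0, e (ctl (code l).t')) := by
      rintro ⟨t, ht⟩ ⟨⟨h1, -⟩, h2⟩
      obtain ⟨p, hp, h⟩ := (mem_gameVASS_T code e).1 ht
      have h3 : t.2.2 = e (ctl (code l).t') := congrArg Prod.fst h2
      rw [h1] at h hp
      simp only [c, Equiv.symm_apply_apply, gameMoves, List.mem_cons, List.not_mem_nil,
        or_false] at hp
      rcases hp with rfl | rfl
      · exact h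
      · rw [h] at h3
        simp at h3
    simp only [Finset.mem_filter, Finset.mem_univ, true_and] at ht ht'
    exact Subtype.ext ((key t ht).trans (key t' ht').symm)
  have h2 : 0 < (gameVASS code e).stepWeight c c₂ :=
    ((gameVASS code e).stepWeight_pos_iff c c₂).2 (gameVASS_step_zero.2 (.inr ⟨hv, rfl⟩))
  have h12 : (gameVASS code e).toMDP.p c hP hc c₁ ≤ (gameVASS code e).toMDP.p c hP hc c₂ := by
    change ((gameVASS code e).stepWeight c c₁ : ℝ≥0∞) / _ ≤
      ((gameVASS code e).stepWeight c c₂ : ℝ≥0∞) / _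
    refine ENNReal.div_le_div_right ?_ _
    exact_mod_cast h1.trans h2
  have hsum : (gameVASS code e).toMDP.p c hP hc c₁ + (gameVASS code e).toMDP.p c hP hc c₂ ≤ 1 := by
    rw [← PMF.tsum_coe ((gameVASS code e).toMDP.p c hP hc), ← Finset.sum_pair hne]
    exact ENNReal.sum_le_tsum _
  rw [← one_div, ENNReal.le_div_iff_mul_le (by simp) (by simp), mul_two]
  exact (add_le_add_right h12 _).trans hsum

/-- The value is 1/2 on the run of the machine, 1 off it and 0 in the sink. A claim alters neither
label nor counters, and executing a true one stays on the run. A false "positive" deadlocks; a false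
"zero" on the run leads to a value of at most 1 with probability at most 1/2, and otherwise to the
sink. -/
theorem isSuperharmonic_gameValue {a₀ : Option L × (Fin 2 → ℕ)}
    (h₀ : ∀ w, ¬ MReach code a₀ (none, w)) :
    (gameVASS code e).toMDP.IsSuperharmonic (gameValue code e a₀) where
  none_eq := rfl
  player1 := by
    rintro ⟨q, v⟩ hP c' hc'
    obtain ⟨q, rfl⟩ := e.surjective q
    obtain ⟨a, rfl⟩ := gameVASS_mem_player1.1 hP
    by_cases ha : MReach code a₀ (a, v)
    · cases a with
      | none => exact absurd ha (h₀ v)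
      | some l =>
        rw [gameValue_of_reach (q := ctl (some l)) rfl ha]
        rcases gameVASS_step_ctl_some.1 hc' with rfl | rfl
        · exact (gameValue_of_reach (q := pos l) rfl ha).le
        · exact (gameValue_of_reach (q := zero l) rfl ha).le
    · rw [gameValue_of_not_reach (q := ctl a) rfl ha]
      exact gameValue_le_one _
  playerP := by
    rintro ⟨q, v⟩ hP hc
    obtain ⟨q, rfl⟩ := e.surjective q
    cases hq : q.label with
    | none =>
      cases q <;> simp [label] at hq
      obtain ⟨c', hc'⟩ := hc
      exact absurd hc' gameVASS_not_step_sink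
    | some a =>
      by_cases ha : MReach code a₀ (a, v)
      · rw [gameValue_of_reach hq ha]
        cases q with
        | ctl a => exact absurd (gameVASS_mem_player1.2 ⟨a, rfl⟩) hP
        | sink => simp [label] at hq
        | pos l =>
          obtain rfl : some l = a := Option.some.inj hq
          refine tsum_le_of_step _ hP hc (fun c' => gameValue code e a₀ (some c')) _ fun c' hc' => ?_
          obtain ⟨hv, rfl⟩ := gameVASS_step_pos.1 hc'
          exact (gameValue_of_reach (q := ctl _) rfl (ha.tail (.pos l v hv))).le
        | zero l =>
          obtain rfl : some l = a := Option.some.inj hq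
          rcases Nat.eq_zero_or_pos (v (code l).i) with hv | hv
          · refine tsum_le_of_step _ hP hc (fun c' => gameValue code e a₀ (some c')) _
              fun c' hc' => ?_
            rw [gameVASS_step_zero, hv] at hc'
            obtain rfl := hc'.resolve_right (by simp)
            exact (gameValue_of_reach (q := ctl _) rfl (ha.tail (.zero l v hv))).le
          · rw [tsum_eq_single (e (ctl (code l).t'), v)]
            · exact (mul_le_of_le_one_right' (gameValue_le_one _)).trans
                (gameVASS_p_zero_le hv hP hc)
            · intro c' hne
              by_cases hs : (gameVASS code e).toMDP.step (e (zero l), v) c'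
              · obtain ⟨-, rfl⟩ := (gameVASS_step_zero.1 hs).resolve_left hne
                rw [gameValue_sink, mul_zero]
              · have : (gameVASS code e).toMDP.p (e (zero l), v) hP hc c' = 0 := by
                  simpa using mt ((gameVASS code e).toMDP.p_pos _ hP hc c').1 hs
                rw [this, zero_mul]
      · rw [gameValue_of_not_reach hq ha]
        exact tsum_le_of_step _ hP hc (fun c' => gameValue code e a₀ (some c')) _
          fun c' _ => gameValue_le_one _

/-- The start lies on the run and has value 1/2; the target is absorbing and off the run, so it has
value 1. -/
theorem playMeasure_reachMaximal_le {a₀ : Option L × (Fin 2 → ℕ)}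
    (h₀ : ∀ w, ¬ MReach code a₀ (none, w)) (σ : (gameVASS code e).toMDP.Strategy) :
    (gameVASS code e).toMDP.playMeasure (e (ctl a₀.1), a₀.2) σ
      (reachMaximal (e (ctl none))) ≤ 2⁻¹ := by
  have h := (isSuperharmonic_gameValue h₀).playMeasure_le (c₀ := (e (ctl a₀.1), a₀.2)) (σ := σ)
    {c | c.1 = e (ctl none)} ?_ ?_
  · rw [gameValue_of_reach (q := ctl a₀.1) rfl Relation.ReflTransGen.refl] at h
    refine le_trans (MeasureTheory.measure_mono ?_) h
    rintro ω ⟨i, v, hi⟩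
    exact ⟨i, _, rfl, hi⟩
  · rintro ⟨q, v⟩ rfl
    exact (gameValue_of_not_reach (q := ctl none) rfl (h₀ v)).ge
  · rintro ⟨q, v⟩ rfl
    refine ⟨not_not.2 ⟨_, gameVASS_step_ctl_none.2 rfl⟩, fun c' hc' => ?_⟩
    rw [gameVASS_step_ctl_none.1 hc']
    rfl

/-! ### Undecidability -/

namespace MDP

variable {C : Type} [Countable C] {M : MDP C} {c₀ : C} {A : Set (ℕ → Option C)}

theorem Surely.almostSurely (h : M.Surely c₀ A) : M.AlmostSurely c₀ A := by
  obtain ⟨σ, hσ⟩ := h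
  exact ⟨σ, playMeasure_eq_one_of_plays_subset hσ⟩

theorem AlmostSurely.limitSurely (h : M.AlmostSurely c₀ A) : M.LimitSurely c₀ A := by
  obtain ⟨σ, hσ⟩ := h
  exact le_antisymm (iSup_le fun σ => MeasureTheory.prob_le_one)
    (hσ.ge.trans (le_iSup (fun σ => M.playMeasure c₀ σ A) σ))

end MDP

section Objectives

variable {Q : Type} {n : ℕ}

theorem reachInfinite_subset (q : Q) :
    (reachInfinite q : Set (ℕ → Option (Config Q n))) ⊆ reachMaximal q := fun _ h => h.2

theorem repeatedReach_subset (q : Q) :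
    (repeatedReach q : Set (ℕ → Option (Config Q n))) ⊆ reachInfinite q := by
  rintro ω ⟨h1, h2⟩
  obtain ⟨i, v, h⟩ := h2.nonempty
  exact ⟨h1, i, v, h⟩

end Objectives

/-- The game for the machine `F` whose first counter starts with the value `x`. -/
noncomputable def gameInstance (F : Fragment) {k : ℕ} (e : GState F.L ≃ Fin k) (x : ℕ) :
    PInstance where
  k := k
  S := gameVASS F.code e
  isP := gameVASS_isPVASSMDP F.code e
  init := (e (.ctl (some F.entry)), ![x, 0])
  target := e (.ctl none)

/-- Only the initial counter depends on `x`. All the rest of the code is a constant, so the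
noncomputable construction of the game does no harm. -/
theorem exists_represents_gameInstance (F : Fragment) {k : ℕ} (e : GState F.L ≃ Fin k) :
    ∃ w : ℕ → Code, Computable w ∧ ∀ x, Represents (w x) (gameInstance F e x) := by
  classical
  let l : List ((ℕ × (ℤ × ℤ) × ℕ) × ℕ) := (Finset.univ.image
    fun t : {t : Transition (Fin k) 2 // t ∈ (gameVASS F.code e).T} =>
      ((((t.1.1 : ℕ), (t.1.2.1 0, t.1.2.1 1), (t.1.2.2 : ℕ)),
        (((gameVASS F.code e).τ t : ℕ+) : ℕ)) : (ℕ × (ℤ × ℤ) × ℕ) × ℕ)).toList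
  refine ⟨fun x => (List.ofFn fun q => decide (q ∈ (gameVASS F.code e).Q₁), l,
    ((e (.ctl (some F.entry)) : ℕ), x, 0), (e (.ctl none) : ℕ)), ?_, fun x => ?_⟩
  · exact (Computable.const _).pair ((Computable.const _).pair
      (((Computable.const _).pair (Computable.id.pair (Computable.const _))).pair
        (Computable.const _)))
  · refine ⟨?_, Finset.nodup_toList _, fun y => ?_, rfl, rfl⟩
    · simp only [gameInstance]
      congr
    · simp only [l, Finset.mem_toList, Finset.mem_image, Finset.mem_univ, true_and]
      exact exists_congr fun t => eq_comm

/-- On game instances `P` coincides with halting: a halting machine gives sure winning for `A I`,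
while a non-halting one bounds the probability of `A I` by 1/2 and so excludes limit-sure winning.
-/
theorem not_isDecidable_of_bounds (P : PInstance → Prop)
    (A : ∀ I : PInstance, Set (ℕ → Option (Config (Fin I.k) 2)))
    (hlo : ∀ I, repeatedReach I.target ⊆ A I) (hhi : ∀ I, A I ⊆ reachMaximal I.target)
    (h1 : ∀ I, I.S.toMDP.Surely I.init (A I) → P I)
    (h2 : ∀ I, P I → I.S.toMDP.LimitSurely I.init (A I)) : ¬ IsDecidable P := by
  rintro ⟨f, hf, hfP⟩
  obtain ⟨F, hF⟩ := Fragment.exists_universal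
  have := F.fin
  obtain ⟨k, ⟨e⟩⟩ := Finite.exists_equiv_fin (GState F.L)
  obtain ⟨w, hw, hwI⟩ := exists_represents_gameInstance F e
  have key : ∀ c : Nat.Partrec.Code,
      P (gameInstance F e (startValue (Encodable.encode c))) ↔ (c.eval 0).Dom := by
    intro c
    rw [← hF]
    set I := gameInstance F e (startValue (Encodable.encode c))
    constructor
    · intro hP
      by_contra! hne
      have hle : I.S.toMDP.maxProb I.init (A I) ≤ 2⁻¹ :=
        iSup_le fun σ => (MeasureTheory.measure_mono (hhi I)).trans
          (playMeasure_reachMaximal_le (e := e)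
            (a₀ := (some F.entry, ![startValue (Encodable.encode c), 0])) hne σ)
      rw [h2 I hP] at hle
      exact absurd hle (by simp)
    · rintro ⟨v, hv⟩
      exact h1 I ⟨honest F.code e, (plays_honest_subset (e := e) hv).trans (hlo I)⟩
  refine ComputablePred.halting_problem 0 ?_
  refine ComputablePred.computable_iff.2
    ⟨fun c => f (w (startValue (Encodable.encode c))), ?_, ?_⟩
  · exact hf.comp (hw.comp (computable_startValue.comp Computable.encode))
  · funext c
    rw [← key c, ← hfP _ _ (hwI _)]

/-- The sure, the almost-sure and the limit-sure problem are undecidable for every objective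
between repeated reachability and reachability. -/
theorem not_isDecidable_objective (A : ∀ I : PInstance, Set (ℕ → Option (Config (Fin I.k) 2)))
    (hlo : ∀ I, repeatedReach I.target ⊆ A I) (hhi : ∀ I, A I ⊆ reachMaximal I.target) :
    ¬ IsDecidable (fun I => I.S.toMDP.Surely I.init (A I)) ∧
      ¬ IsDecidable (fun I => I.S.toMDP.AlmostSurely I.init (A I)) ∧
      ¬ IsDecidable (fun I => I.S.toMDP.LimitSurely I.init (A I)) :=
  ⟨not_isDecidable_of_bounds _ A hlo hhi (fun _ h => h) fun _ h => h.almostSurely.limitSurely,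
    not_isDecidable_of_bounds _ A hlo hhi (fun _ h => h.almostSurely) fun _ h => h.limitSurely,
    not_isDecidable_of_bounds _ A hlo hhi (fun _ h => h.almostSurely.limitSurely) fun _ h => h⟩

end VASSInduced

theorem mainTheorem6 :
    -- reachability, for the objective "infinite plays that visit the target"
    (¬ VASSInduced.IsDecidable VASSInduced.SureReach ∧
      ¬ VASSInduced.IsDecidable VASSInduced.AlmostSureReach ∧
      ¬ VASSInduced.IsDecidable VASSInduced.LimitSureReach) ∧
    -- reachability, for the objective "maximal plays (deadlocked or not) that visit the target"
    (¬ VASSInduced.IsDecidable VASSInduced.SureReachMaximal ∧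
      ¬ VASSInduced.IsDecidable VASSInduced.AlmostSureReachMaximal ∧
      ¬ VASSInduced.IsDecidable VASSInduced.LimitSureReachMaximal) ∧
    -- repeated reachability
    (¬ VASSInduced.IsDecidable VASSInduced.SureRepeatedReach ∧
      ¬ VASSInduced.IsDecidable VASSInduced.AlmostSureRepeatedReach ∧
      ¬ VASSInduced.IsDecidable VASSInduced.LimitSureRepeatedReach) :=
  ⟨VASSInduced.not_isDecidable_objective (fun I => VASSInduced.reachInfinite I.target)
      (fun _ => VASSInduced.repeatedReach_subset _) fun _ => VASSInduced.reachInfinite_subset _,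
    VASSInduced.not_isDecidable_objective (fun I => VASSInduced.reachMaximal I.target)
      (fun _ => (VASSInduced.repeatedReach_subset _).trans (VASSInduced.reachInfinite_subset _))
      fun _ => subset_rfl,
    VASSInduced.not_isDecidable_objective (fun I => VASSInduced.repeatedReach I.target)
      (fun _ => subset_rfl)
      fun _ => (VASSInduced.repeatedReach_subset _).trans (VASSInduced.reachInfinite_subset _)⟩
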